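/- For $\alpha\in\mathbb C\setminus(-\infty,0)$, with principal square roots and $x\coth x:=1$ at $x=0$, let $$S(\alpha)=-\frac1{8\pi^2}\int_0^\infty\frac{e^{-is}}{s^3}\Big\{2\sqrt{\pi\alpha}\,s\,\coth(2\sqrt{\pi\alpha}\,s)-1-\frac{4\pi\alpha s^2}{3}\Big\}\,ds$$ (an improper integral $\lim_{T\to\infty}\int_0^T$) be the Schwinger effective action for a constant external electric field. Let $$a_n=-\frac{(-1)^n}{8\pi^2}(16\pi)^nB_{2n}\frac{(2n-3)!}{(2n)!}\quad(n\ge2),$$ where $B_{2n}$ are the Bernoulli numbers, and $a_0=a_1=0$. Definitions. For a formal power series $\sum b_nz^n$ assume that its Borel transform $B(t)=\sum b_nt^n/n!$ converges for $|t|<C$ for some $C>0$ and continues analytically to the intersection of the upper half-plane with a neighbourhood of $[0,\infty)$, and that the limit $B(t+i0)=\lim_{\varepsilon\to0+}B(t+i\varepsilon)$ exists on $[0,\infty)$ in the sense of distributions. For $R>0$ let $C_R=\{z:\mathrm{Re}\,z^{-1}>R^{-1}\}$. If, for all $z\in C_R$, the integral $\frac1z\int_0^\infty D(t)e^{-t/z}\,dt$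 converges (as the limit over dilated smooth compactly supported cutoffs, equal to $1$ near $0$, independently of the cutoff), its value is called the upper sum, the lower sum, or the distributional Borel sum of the series on $C_R$ according as $D=B(t+i0)$, $D=\overline{B(t+i0)}$, or $D=\frac12\{B(t+i0)+\overline{B(t+i0)}\}$. Theorem. The integral defining $S(\alpha)$ converges for $|\arg\alpha|<\pi$, and $S$ is analytic there. One has $a_n>0$ for $n\ge2$ and $a_n$ grows like $(2n)!$ up to a geometric and a power factor, namely $a_n\sim\frac{(4/\pi)^n(2n)!}{32\pi^2n^3}$ as $n\to\infty$. The perturbation expansion of $S$ is $-\sum_{n\ge2}a_n\alpha^n$: for every $N\ge0$, $S(\alpha)+\sum_{n<N}a_n\alpha^n=O(\alpha^N)$ as $\alpha\to0$ with $\mathrm{Re}\,\alpha>0$. This expansion is Borel summable in the distributional sense in the variable $\beta=\sqrt\alpha$: for every $R>0$, the power series $-\sum_{n\ge2}a_n\beta^{2n}$ has on $C_R$ the upper sum $S(\beta^2)$, the lower sum $\overline{S(\overline{\beta^2})}$ and the distributional Borel sum $\frac12\{S(\beta^2)+\overline{S(\overline{\beta^2})}\}$. Since every $\beta$ with $\mathrm{Re}\,\beta>0$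 lies in some $C_R$, this covers all $\alpha=\beta^2$ with $|\arg\alpha|<\pi$, in particular $\mathrm{Re}\,\alpha>0$. For real $\alpha\ge0$ the function $\frac12\{S(\alpha)+\overline{S(\overline\alpha)}\}$ equals $\mathrm{Re}\,S(\alpha)$, and $S(0)=0$. -/

import Mathlib

open Complex Filter Topology MeasureTheory Asymptotics
open scoped Distributions ContDiff ComplexConjugate

namespace Schwinger

noncomputable section

/-! ### Distributional Borel summability -/

/-- The disk `C_R`, tangent to the imaginary axis at the origin. -/
def disk (R : ℝ) : Set ℂ := {z | R⁻¹ < (z⁻¹).re}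

/-- Value of a complex distribution on `ℝ` at a complex test function
(a Mathlib distribution acts on real test functions; this is its `ℂ`-linear extension). -/
def pair (T : 𝓓'((⊤ : TopologicalSpace.Opens ℝ), ℂ))
    (φ : 𝓓((⊤ : TopologicalSpace.Opens ℝ), ℂ)) : ℂ :=
  T (TestFunction.postcompCLM reCLM φ) + I * T (TestFunction.postcompCLM imCLM φ)

/-- The complex conjugate distribution. -/
def conjDist (T : 𝓓'((⊤ : TopologicalSpace.Opens ℝ), ℂ)) :
    𝓓'((⊤ : TopologicalSpace.Opens ℝ), ℂ) :=
  Distribution.mapCLM (conjCLE : ℂ →L[ℝ] ℂ) T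

/-- `PP(T) = (T + conj T) / 2`. -/
def PP (T : 𝓓'((⊤ : TopologicalSpace.Opens ℝ), ℂ)) :
    𝓓'((⊤ : TopologicalSpace.Opens ℝ), ℂ) :=
  (1 / 2 : ℝ) • (T + conjDist T)

/-- `T` is the boundary value `B(t + i0)`, `t ≥ 0`, of the Borel transform
`B(t) = ∑ bₙ tⁿ / n!` of the formal power series `∑ bₙ zⁿ`: the Borel transform converges in a
disk `|t| < C`, continues analytically to the intersection of the upper half-plane with a
neighbourhood `U` of `[0, ∞)`, and `T` is the distribution on `ℝ`, carried by `[0, ∞)`, which is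
the limit of `B(t + iε)` on `[0, ∞)` as `ε → 0+`. (Since `B` is analytic at `0`, the sharp cut
at `t = 0` is harmless.) -/
def IsBoundaryBorelTransform (b : ℕ → ℂ) (T : 𝓓'((⊤ : TopologicalSpace.Opens ℝ), ℂ)) : Prop :=
  ∃ (C : ℝ) (U : Set ℂ) (B : ℂ → ℂ), 0 < C ∧ IsOpen U ∧ (∀ t : ℝ, 0 ≤ t → (t : ℂ) ∈ U) ∧
    (∀ t ∈ Metric.ball (0 : ℂ) C, HasSum (fun n : ℕ => b n / (n.factorial : ℂ) * t ^ n) (B t)) ∧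
    DifferentiableOn ℂ B (Metric.ball 0 C ∪ (U ∩ {t | 0 < t.im})) ∧
    ∀ φ : 𝓓((⊤ : TopologicalSpace.Opens ℝ), ℝ),
      Tendsto (fun ε : ℝ => ∫ t in Set.Ioi (0 : ℝ), B (t + ε * I) * (φ t : ℂ))
        (𝓝[>] 0) (𝓝 (T φ))

/-- The test function `t ↦ χ(t / (m + 1)) exp(-t / z)`. -/
def laplaceTest (χ : 𝓓((⊤ : TopologicalSpace.Opens ℝ), ℝ)) (z : ℂ) (m : ℕ) :
    𝓓((⊤ : TopologicalSpace.Opens ℝ), ℂ) where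
  toFun t := (χ (t / ((m : ℝ) + 1)) : ℂ) * cexp (-(t : ℂ) / z)
  contDiff' := by
    have h1 : ContDiff ℝ ∞ (fun t : ℝ => χ (t / ((m : ℝ) + 1))) :=
      χ.contDiff.comp (contDiff_id.div_const _)
    have h2 : ContDiff ℝ ∞ (fun t : ℝ => (χ (t / ((m : ℝ) + 1)) : ℂ)) :=
      ofRealCLM.contDiff.comp h1
    have h3 : ContDiff ℝ ∞ (fun t : ℝ => (t : ℂ)) := ofRealCLM.contDiff
    exact h2.mul (h3.neg.div_const z).cexp
  hasCompactSupport' := by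
    have hm : ((m : ℝ) + 1)⁻¹ ≠ 0 := by positivity
    have h1 : HasCompactSupport (fun t : ℝ => χ (t / ((m : ℝ) + 1))) := by
      simp only [div_eq_mul_inv]
      exact χ.hasCompactSupport.comp_homeomorph (Homeomorph.mulRight₀ _ hm)
    have h2 : HasCompactSupport (fun t : ℝ => (χ (t / ((m : ℝ) + 1)) : ℂ)) :=
      h1.comp_left (g := fun x : ℝ => (x : ℂ)) ofReal_zero
    exact h2.mul_right
  tsupport_subset' := by simp

/-- The Laplace-Borel integral `z⁻¹ ∫₀^∞ T(t) exp(-t / z) dt` of a distribution `T` carried by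
`[0, ∞)` converges to `L`: for every smooth cutoff `χ` with compact support that equals `1` near
`0`, the values `z⁻¹ ⟨T, χ(t / m) exp(-t / z)⟩` tend to `L` as `m → ∞`. -/
def HasLaplaceBorelIntegral (T : 𝓓'((⊤ : TopologicalSpace.Opens ℝ), ℂ)) (z L : ℂ) : Prop :=
  ∀ χ : 𝓓((⊤ : TopologicalSpace.Opens ℝ), ℝ), (∀ᶠ t in 𝓝 (0 : ℝ), χ t = 1) →
    Tendsto (fun m : ℕ => z⁻¹ * pair T (laplaceTest χ z m)) atTop (𝓝 L)

/-- `∑ bₙ zⁿ` is Borel summable in the distributional sense to `f` on `C_R`. -/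
def IsDistBorelSum (b : ℕ → ℂ) (R : ℝ) (f : ℂ → ℂ) : Prop :=
  ∃ T, IsBoundaryBorelTransform b T ∧ ∀ z ∈ disk R, HasLaplaceBorelIntegral (PP T) z (f z)

/-- `Φ` is the upper sum of `∑ bₙ zⁿ` on `C_R`. -/
def IsUpperSum (b : ℕ → ℂ) (R : ℝ) (Φ : ℂ → ℂ) : Prop :=
  ∃ T, IsBoundaryBorelTransform b T ∧ ∀ z ∈ disk R, HasLaplaceBorelIntegral T z (Φ z)

/-- `Ψ` is the lower sum of `∑ bₙ zⁿ` on `C_R`. -/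
def IsLowerSum (b : ℕ → ℂ) (R : ℝ) (Ψ : ℂ → ℂ) : Prop :=
  ∃ T, IsBoundaryBorelTransform b T ∧ ∀ z ∈ disk R, HasLaplaceBorelIntegral (conjDist T) z (Ψ z)

/-- The coefficients of `∑ aₙ αⁿ` as a power series `∑ aₙ β²ⁿ` in `β = √α`. -/
def sqrtSeries (a : ℕ → ℂ) (k : ℕ) : ℂ := if Even k then a (k / 2) else 0

/-! ### The effective action -/

/-- The function `x coth x`, with value `1` at `0`. -/
def xcoth (x : ℂ) : ℂ := if x = 0 then 1 else x * (cosh x / sinh x)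

/-- The integrand of the effective action. -/
def integrand (α : ℂ) (s : ℝ) : ℂ :=
  cexp (-I * s) / (s : ℂ) ^ 3 *
    (xcoth (2 * ((Real.pi : ℂ) * α) ^ (1 / 2 : ℂ) * s) - 1 - 4 * Real.pi * α * (s : ℂ) ^ 2 / 3)

/-- The effective action integrated up to `T`. -/
def actionUpTo (α : ℂ) (T : ℝ) : ℂ :=
  -(1 / (8 * (Real.pi : ℂ) ^ 2)) * ∫ s in (0 : ℝ)..T, integrand α s

/-- The effective action `S(α)`, a conditionally convergent improper integral. -/
def S (α : ℂ) : ℂ := limUnder atTop (actionUpTo α)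

/-- The numbers `aₙ`, with `aₙ = 0` for `n < 2`. -/
def a (n : ℕ) : ℝ :=
  if n < 2 then 0 else
    -((-1) ^ n / (8 * Real.pi ^ 2)) * (16 * Real.pi) ^ n * (bernoulli (2 * n) : ℝ) *
      ((2 * n - 3).factorial / (2 * n).factorial)

/-- The coefficients `-aₙ` of the perturbation expansion of `S(α)`. -/
def coeff (n : ℕ) : ℂ := -(a n : ℂ)

end

end Schwinger

namespace Schwinger

/-! ### Laplace integrals of powers -/

/-! Both the effective action and the Borel transform split into sums over the poles of `coth`, and
the theorem reduces to one identity for a single pole. Write `α = β²` with `Re β > 0`, `p_k =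
(k+1)√π/2` and `w = β/p_k`. The partial fractions of `coth` (`hasSum_xcoth`) turn the integrand of
`S` into `∑ -2 w⁴ e^{-is} s/(1 + w²s²)`. Euler's formula for `ζ(2n)` writes `a_n` as a power sum
over the `p_k` (`a_eq`), so the Borel transform in `β` is `-(1/4π²) ∑ kernel(t/p_k)`, where `kernel`
is elementary with third derivative `u/(1-u²)`. Its singularities at `±1` are only of type `z² log
z`. Hence `borel` is continuous up to the positive axis, its boundary value is an ordinary function,
and the bound `‖kernel u‖ ≤ C‖u‖⁴` makes all sums and Laplace integrals converge absolutely. The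
identity for one pole is `integral_kernel_mul_exp`. The Laplace integral of `kernel` is rotated
through the upper half-plane towards the direction `I w` (`rayLaplace_eq`), where the exponential
becomes `e^{-is}`. Four integrations by parts replace `kernel` by its fourth derivative, which is
integrable there (`integral_kernel_eq_integral_kernel₄`). One integration by parts on the action
side (`integral_osc_eq`) produces the same integral. Approaching the axis from above selects `S`
itself as the upper sum. Summing over poles gives `S(β²) = laplaceBorel β` (`S_sq`). The limit `T →
∞` passes through the sum because each oscillating integral is bounded by a constant times `1/‖w‖`,
uniformly in `T` (`norm_integral_osc_le`). The rest follows from this formula. Analyticity is that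
of a Laplace integral composed with the principal root. The expansion is Watson's lemma applied to a
global Taylor bound for `borel`. The lower sum is the conjugate of the upper sum at the conjugate
point, and the distributional sum is their mean. Positivity and growth of `a_n` are read off from
the power sum, which the pole nearest the origin dominates. -/

theorem integrableOn_pow_mul_exp_neg_mul (n : ℕ) {c : ℝ} (hc : 0 < c) :
    IntegrableOn (fun t : ℝ => t ^ n * Real.exp (-(c * t))) (Set.Ioi 0) := by
  have h := integrableOn_rpow_mul_exp_neg_mul_rpow (p := 1) (s := (n : ℝ)) (b := c)
    (by have : (0 : ℝ) ≤ n := n.cast_nonneg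
        linarith) one_pos hc
  refine h.congr_fun (fun t _ => ?_) measurableSet_Ioi
  simp [Real.rpow_natCast]

theorem integral_pow_mul_exp_neg_mul (n : ℕ) {c : ℝ} (hc : 0 < c) :
    ∫ t in Set.Ioi (0 : ℝ), t ^ n * Real.exp (-(c * t)) = n.factorial / c ^ (n + 1) := by
  have h := Real.integral_rpow_mul_exp_neg_mul_Ioi (a := (n : ℝ) + 1) (r := c) (by positivity) hc
  rw [Real.Gamma_nat_eq_factorial] at h
  have h2 : ((1 / c) ^ ((n : ℝ) + 1) : ℝ) = 1 / c ^ (n + 1) := by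
    rw [← Nat.cast_succ, Real.rpow_natCast, div_pow, one_pow]
  rw [h2] at h
  rw [div_eq_mul_one_div, mul_comm, ← h]
  refine setIntegral_congr_fun measurableSet_Ioi fun t _ => ?_
  simp [Real.rpow_natCast]

theorem norm_cexp_neg_mul (p : ℂ) (t : ℝ) : ‖cexp (-(p * t))‖ = Real.exp (-(p.re * t)) := by
  rw [Complex.norm_exp]; simp

theorem tendsto_pow_mul_exp_neg_mul (n : ℕ) {c : ℝ} (hc : 0 < c) :
    Tendsto (fun t : ℝ => t ^ n * Real.exp (-(c * t))) atTop (𝓝 0) := by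
  have h := tendsto_rpow_mul_exp_neg_mul_atTop_nhds_zero n c hc
  refine h.congr fun t => ?_
  rw [Real.rpow_natCast, neg_mul]

theorem integrableOn_of_norm_le_pow_mul_exp {f : ℝ → ℂ} {C c : ℝ} {n : ℕ} (hc : 0 < c)
    (hf : AEStronglyMeasurable f (volume.restrict (Set.Ioi 0)))
    (h : ∀ t : ℝ, 0 < t → ‖f t‖ ≤ C * (t ^ n * Real.exp (-(c * t)))) :
    IntegrableOn f (Set.Ioi 0) := by
  refine ((integrableOn_pow_mul_exp_neg_mul n hc).const_mul C).mono' hf ?_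
  filter_upwards [ae_restrict_mem measurableSet_Ioi] with t ht using h t ht

theorem integrableOn_pow_mul_cexp_neg_mul (n : ℕ) {p : ℂ} (hp : 0 < p.re) :
    IntegrableOn (fun t : ℝ => (t : ℂ) ^ n * cexp (-(p * t))) (Set.Ioi 0) := by
  refine integrableOn_of_norm_le_pow_mul_exp (C := 1) (n := n) hp ?_ fun t ht => ?_
  · exact (by fun_prop : Continuous fun t : ℝ => (t : ℂ) ^ n * cexp (-(p * t))).aestronglyMeasurable
  · rw [norm_mul, norm_cexp_neg_mul, norm_pow, Complex.norm_real, Real.norm_of_nonneg ht.le, one_mul]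

theorem integral_pow_mul_cexp_neg_mul (n : ℕ) {p : ℂ} (hp : 0 < p.re) :
    ∫ t in Set.Ioi (0 : ℝ), (t : ℂ) ^ n * cexp (-(p * t)) = n.factorial / p ^ (n + 1) := by
  have hp0 : p ≠ 0 := by rintro rfl; simp at hp
  have hE : ∀ t : ℝ, HasDerivAt (fun t : ℝ => cexp (-(p * t))) (cexp (-(p * t)) * (-p)) t := by
    intro t
    have h1 : HasDerivAt (fun t : ℝ => -(p * (t : ℂ))) (-p) t := by
      simpa using ((hasDerivAt_id t).ofReal_comp.const_mul p).fun_neg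
    exact h1.cexp
  have hlim : ∀ k : ℕ, Tendsto (fun t : ℝ => (t : ℂ) ^ k * cexp (-(p * t))) atTop (𝓝 0) := by
    intro k
    rw [tendsto_zero_iff_norm_tendsto_zero]
    refine (tendsto_pow_mul_exp_neg_mul k hp).congr' ?_
    filter_upwards [eventually_gt_atTop 0] with t ht
    rw [norm_mul, norm_cexp_neg_mul, norm_pow, Complex.norm_real, Real.norm_of_nonneg ht.le]
  induction n with
  | zero =>
    have h := integral_Ioi_of_hasDerivAt_of_tendsto' (a := 0) (fun t _ => hE t)
      (by
        have := (integrableOn_pow_mul_cexp_neg_mul 0 hp).mul_const (-p)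
        simpa only [pow_zero, one_mul] using! this)
      (by simpa using hlim 0)
    rw [integral_mul_const] at h
    simp only [pow_zero, one_mul, Nat.factorial_zero, Nat.cast_one, zero_add, pow_one]
    field_simp
    simpa [mul_comm] using h
  | succ n ih =>
    have hd : ∀ t : ℝ, HasDerivAt (fun t : ℝ => (t : ℂ) ^ (n + 1) * cexp (-(p * t)))
        ((n + 1 : ℂ) * ((t : ℂ) ^ n * cexp (-(p * t)))
          - p * ((t : ℂ) ^ (n + 1) * cexp (-(p * t)))) t := by
      intro t
      have h1 : HasDerivAt (fun t : ℝ => (t : ℂ) ^ (n + 1)) ((n + 1 : ℂ) * (t : ℂ) ^ n) t := by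
        simpa using (hasDerivAt_id t).ofReal_comp.fun_pow (n + 1)
      exact (h1.fun_mul (hE t)).congr_deriv (by ring)
    have hi1 := (integrableOn_pow_mul_cexp_neg_mul n hp).const_mul (n + 1 : ℂ)
    have hi2 := (integrableOn_pow_mul_cexp_neg_mul (n + 1) hp).const_mul p
    have h := integral_Ioi_of_hasDerivAt_of_tendsto' (a := 0) (fun t _ => hd t)
      (hi1.sub hi2) (hlim (n + 1))
    rw [integral_sub hi1 hi2, integral_const_mul, integral_const_mul, ih] at h
    simp only [ofReal_zero, ne_eq, Nat.add_eq_zero_iff, one_ne_zero, and_false, not_false_eq_true,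
      zero_pow, zero_mul, sub_zero, sub_eq_zero] at h
    rw [Nat.factorial_succ]
    push_cast
    field_simp at h ⊢
    rw [h]; ring

/-! ### Holomorphic parameter integrals -/

/-- An integral depending holomorphically on a parameter, with locally uniform integrable bound,
is holomorphic. -/
theorem differentiableAt_integral_of_dominated {α : Type*} [MeasurableSpace α] {μ : Measure α}
    {F : ℂ → α → ℂ} {z₀ : ℂ} {r : ℝ} (hr : 0 < r) {b : α → ℝ}
    (hmeas : ∀ z ∈ Metric.ball z₀ r, AEStronglyMeasurable (F z) μ)
    (hdiff : ∀ᵐ s ∂μ, DifferentiableOn ℂ (fun z => F z s) (Metric.ball z₀ r))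
    (hbound : ∀ᵐ s ∂μ, ∀ z ∈ Metric.ball z₀ r, ‖F z s‖ ≤ b s) (hb : Integrable b μ) :
    DifferentiableAt ℂ (fun z => ∫ s, F z s ∂μ) z₀ := by
  have hd : ∀ᵐ s ∂μ, ∀ z ∈ Metric.ball z₀ (r / 2),
      HasDerivAt (fun z => F z s) (deriv (fun z => F z s) z) z := by
    filter_upwards [hdiff] with s hs z hz
    exact (hs.differentiableAt (Metric.isOpen_ball.mem_nhds
      (Metric.ball_subset_ball (by linarith) hz))).hasDerivAt
  have hsub : ∀ z ∈ Metric.ball z₀ (r / 2), ∀ y ∈ Metric.closedBall z (r / 3),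
      y ∈ Metric.ball z₀ r := by
    intro z hz y hy
    rw [Metric.mem_ball] at hz ⊢
    rw [Metric.mem_closedBall] at hy
    linarith [dist_triangle y z z₀]
  have h0 : z₀ ∈ Metric.ball z₀ (r / 2) := Metric.mem_ball_self (by linarith)
  refine (hasDerivAt_integral_of_dominated_loc_of_deriv_le
    (F := F) (F' := fun z s => deriv (fun z => F z s) z) (bound := fun s => b s / (r / 3))
    (Metric.ball_mem_nhds z₀ (half_pos hr)) ?_ ?_ ?_ ?_ (hb.div_const _) hd).2.differentiableAt
  · filter_upwards [Metric.ball_mem_nhds z₀ hr] with z hz using hmeas z hz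
  · refine hb.mono' (hmeas z₀ (Metric.mem_ball_self hr)) ?_
    filter_upwards [hbound] with s hs using hs z₀ (Metric.mem_ball_self hr)
  · -- the derivative is a limit of difference quotients
    have hu : Tendsto (fun n : ℕ => z₀ + ((r / 2) * (1 / ((n : ℝ) + 1)) : ℝ)) atTop (𝓝[≠] z₀) := by
      rw [tendsto_nhdsWithin_iff]
      constructor
      · have := (tendsto_one_div_add_atTop_nhds_zero_nat (𝕜 := ℝ)).const_mul (r / 2)
        have h2 := ((continuous_ofReal.tendsto _).comp this).const_add z₀
        simpa using h2
      · refine Eventually.of_forall fun n => ?_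
        have : (r / 2) * (1 / ((n : ℝ) + 1)) ≠ 0 := by positivity
        simp only [Set.mem_compl_iff, Set.mem_singleton_iff, add_eq_left, ofReal_eq_zero]
        exact this
    refine aestronglyMeasurable_of_tendsto_ae (u := atTop)
      (f := fun (n : ℕ) s => slope (fun z => F z s) z₀ (z₀ + ((r / 2) * (1 / ((n : ℝ) + 1)) : ℝ)))
      ?_ ?_
    · intro n
      simp only [slope_def_module]
      refine ((hmeas _ ?_).sub (hmeas z₀ (Metric.mem_ball_self hr))).const_smul (_ : ℂ)
      rw [Metric.mem_ball, dist_eq_norm, add_sub_cancel_left, norm_real, Real.norm_of_nonneg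
        (by positivity)]
      have : 1 / ((n : ℝ) + 1) ≤ 1 := by
        rw [div_le_one (by positivity)]; linarith [n.cast_nonneg (α := ℝ)]
      nlinarith
    · filter_upwards [hd] with s hs
      exact (hasDerivAt_iff_tendsto_slope.1 (hs z₀ h0)).comp hu
  · filter_upwards [hdiff, hbound] with s hs1 hs2 z hz
    -- Cauchy's estimate on the circle of radius `r / 3`, which stays in the large ball when its
    -- centre lies in the ball of radius `r / 2`.
    refine norm_deriv_le_of_forall_mem_sphere_norm_le (by linarith) ?_ ?_
    · refine DifferentiableOn.diffContOnCl ?_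
      rw [closure_ball _ (by linarith)]
      exact hs1.mono fun y hy => hsub z hz y hy
    · intro y hy
      exact hs2 y (hsub z hz y (Metric.sphere_subset_closedBall hy))

/-! ### A lower bound -/

/-- Factor as `(1 + ias)(1 - ias)`. Each factor runs along a line at distance `Re a / ‖a‖` from the
origin and has imaginary part `±s Re a`; the bound is the mean of the two resulting estimates. Up to
scaling, the constant depends only on the aperture `‖a‖ / Re a`. -/
theorem norm_one_add_sq_mul_sq_ge {a : ℂ} (ha : 0 < a.re) (s : ℝ) :
    a.re ^ 2 / (2 * ‖a‖ ^ 2) * (1 + ‖a‖ ^ 2 * s ^ 2) ≤ ‖1 + a ^ 2 * (s : ℂ) ^ 2‖ := by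
  have hn : 0 < ‖a‖ := norm_pos_iff.2 (by rintro rfl; simp at ha)
  have hnsq : ‖a‖ ^ 2 = a.re ^ 2 + a.im ^ 2 := by
    rw [← Complex.normSq_eq_norm_sq, Complex.normSq_apply]; ring
  have key : ∀ σ : ℝ, (σ = 1 ∨ σ = -1) → a.re ^ 2 / ‖a‖ ^ 2 ≤ ‖1 + σ * (I * a * s)‖ ^ 2 ∧
      a.re ^ 2 * s ^ 2 ≤ ‖1 + σ * (I * a * s)‖ ^ 2 := by
    intro σ hσ
    have h1 : ‖1 + σ * (I * a * s)‖ ^ 2 = (1 - σ * a.im * s) ^ 2 + a.re ^ 2 * s ^ 2 := by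
      rw [← Complex.normSq_eq_norm_sq, Complex.normSq_apply]
      rcases hσ with rfl | rfl <;> simp <;> ring
    rw [h1]
    constructor
    · rw [div_le_iff₀ (by positivity), hnsq]
      have hs : σ ^ 2 = 1 := by rcases hσ with rfl | rfl <;> norm_num
      -- The square vanishes at the foot of the perpendicular from the origin to the line; the last
      -- term is zero since `σ² = 1`.
      have : ((1 - σ * a.im * s) ^ 2 + a.re ^ 2 * s ^ 2) * (a.re ^ 2 + a.im ^ 2) - a.re ^ 2
          = ((a.re ^ 2 + a.im ^ 2) * s - σ * a.im) ^ 2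
            + (σ ^ 2 - 1) * (a.im ^ 2 * s ^ 2 * (a.re ^ 2 + a.im ^ 2) - a.im ^ 2) := by ring
      rw [hs] at this
      nlinarith [sq_nonneg ((a.re ^ 2 + a.im ^ 2) * s - σ * a.im)]
    · nlinarith [sq_nonneg (1 - σ * a.im * s)]
  obtain ⟨p1, p2⟩ := key 1 (Or.inl rfl)
  obtain ⟨m1, m2⟩ := key (-1) (Or.inr rfl)
  have hfac : 1 + a ^ 2 * (s : ℂ) ^ 2 = (1 + (1 : ℝ) * (I * a * s)) * (1 + (-1 : ℝ) * (I * a * s)) := by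
    push_cast
    linear_combination (a ^ 2 * (s : ℂ) ^ 2) * I_sq
  rw [hfac, norm_mul]
  set x := ‖1 + ((1 : ℝ) : ℂ) * (I * a * s)‖
  set y := ‖1 + ((-1 : ℝ) : ℂ) * (I * a * s)‖
  have hx : 0 ≤ x := norm_nonneg _
  have hy : 0 ≤ y := norm_nonneg _
  have q1 : a.re ^ 2 / ‖a‖ ^ 2 ≤ x * y := by
    refine abs_le_of_sq_le_sq' ?_ (by positivity) |>.2
    rw [mul_pow]
    calc (a.re ^ 2 / ‖a‖ ^ 2) ^ 2 = (a.re ^ 2 / ‖a‖ ^ 2) * (a.re ^ 2 / ‖a‖ ^ 2) := sq _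
      _ ≤ _ := mul_le_mul p1 m1 (by positivity) (by positivity)
  have q2 : a.re ^ 2 * s ^ 2 ≤ x * y := by
    refine abs_le_of_sq_le_sq' ?_ (by positivity) |>.2
    rw [mul_pow x]
    calc (a.re ^ 2 * s ^ 2) ^ 2 = (a.re ^ 2 * s ^ 2) * (a.re ^ 2 * s ^ 2) := sq _
      _ ≤ _ := mul_le_mul p2 m2 (by positivity) (by positivity)
  have : a.re ^ 2 / (2 * ‖a‖ ^ 2) * (1 + ‖a‖ ^ 2 * s ^ 2)
      = (a.re ^ 2 / ‖a‖ ^ 2 + a.re ^ 2 * s ^ 2) / 2 := by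
    field_simp
  linarith

noncomputable section

/-! ### The elementary Borel kernel -/

/-- The branch of `log (1 - u)` that is analytic in the upper half-plane and in the unit disk, and
continuous up to the real axis. -/
def logOneSub (u : ℂ) : ℂ := log (I * (1 - u)) - Real.pi / 2 * I

/-- The function with third derivative `u / (1 - u ^ 2)` that vanishes to fourth order at `0`. -/
def kernel (u : ℂ) : ℂ :=
  -(1 / 4) * ((1 - u) ^ 2 * logOneSub u + (1 + u) ^ 2 * log (1 + u)) + 3 / 4 * u ^ 2

/-- The first derivative of `kernel`. -/
def kernel₁ (u : ℂ) : ℂ :=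
  1 / 2 * ((1 - u) * logOneSub u - (1 + u) * log (1 + u)) + u

/-- The second derivative of `kernel`. -/
def kernel₂ (u : ℂ) : ℂ := -(1 / 2) * (logOneSub u + log (1 + u))

/-- The third derivative of `kernel`. -/
def kernel₃ (u : ℂ) : ℂ := u / (1 - u ^ 2)

/-- The fourth derivative of `kernel`. -/
def kernel₄ (u : ℂ) : ℂ := (1 + u ^ 2) / (1 - u ^ 2) ^ 2

/-- The Taylor coefficients of `kernel` at `0`. -/
def kernelCoeff (k : ℕ) : ℝ := if Even k then ((k : ℝ) * (k - 1) * (k - 2))⁻¹ else 0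

/-- The factor `I` turns the cut of the logarithm into the vertical ray going down from `u = 1`, so
nothing changes to the left of `Re u = 1`. -/
theorem logOneSub_eq {u : ℂ} (hu : u.re < 1) : logOneSub u = log (1 - u) := by
  have h0 : (1 - u) ≠ 0 := fun h => by
    have := congrArg re h
    simp at this; linarith
  have h1 : 0 < (1 - u).re := by simpa using hu
  have h2 : |(1 - u).arg| < Real.pi / 2 := abs_arg_lt_pi_div_two_iff.2 (Or.inl h1)
  rw [abs_lt] at h2
  rw [logOneSub, Complex.log_mul I_ne_zero h0, log_I]
  · ring
  · rw [arg_I]; constructor <;> linarith [Real.pi_pos]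

/-- The union of the upper half-plane and the unit disk. -/
def kernelDomain : Set ℂ := {u | 0 < u.im} ∪ Metric.ball 0 1

theorem I_mul_one_sub_mem_slitPlane {u : ℂ} (hu : u ∈ kernelDomain) :
    I * (1 - u) ∈ slitPlane := by
  rcases hu with hu | hu
  · left; simpa using hu
  · right
    have h1 : |u.re| ≤ ‖u‖ := abs_re_le_norm u
    have h2 : ‖u‖ < 1 := by simpa using hu
    have : u.re < 1 := (le_abs_self _).trans_lt (h1.trans_lt h2)
    simp; linarith

theorem one_add_mem_slitPlane {u : ℂ} (hu : u ∈ kernelDomain) : 1 + u ∈ slitPlane := by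
  rcases hu with hu | hu
  · right; simpa using (ne_of_gt hu : u.im ≠ 0)
  · exact mem_slitPlane_of_norm_lt_one (by simpa using hu)

theorem hasDerivAt_logOneSub {u : ℂ} (hu : u ∈ kernelDomain) :
    HasDerivAt logOneSub (-(1 - u)⁻¹) u := by
  have hs := I_mul_one_sub_mem_slitPlane hu
  have h0 : (1 - u) ≠ 0 := fun h => slitPlane_ne_zero hs (by rw [h, mul_zero])
  have h1 : HasDerivAt (fun u : ℂ => I * (1 - u)) (I * (-1)) u :=
    ((hasDerivAt_id u).const_sub 1).const_mul I
  refine ((h1.clog hs).sub_const _).congr_deriv ?_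
  field_simp

theorem hasDerivAt_log_one_add {u : ℂ} (hu : u ∈ kernelDomain) :
    HasDerivAt (fun u : ℂ => log (1 + u)) ((1 + u)⁻¹) u := by
  have h1 : HasDerivAt (fun u : ℂ => 1 + u) 1 u := (hasDerivAt_id u).const_add 1
  simpa using h1.clog (one_add_mem_slitPlane hu)

theorem one_sub_ne_zero {u : ℂ} (hu : u ∈ kernelDomain) : 1 - u ≠ 0 := fun h =>
  slitPlane_ne_zero (I_mul_one_sub_mem_slitPlane hu) (by rw [h, mul_zero])

theorem one_add_ne_zero {u : ℂ} (hu : u ∈ kernelDomain) : 1 + u ≠ 0 :=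
  slitPlane_ne_zero (one_add_mem_slitPlane hu)

theorem one_sub_sq_ne_zero {u : ℂ} (hu : u ∈ kernelDomain) : 1 - u ^ 2 ≠ 0 := by
  rw [show 1 - u ^ 2 = (1 - u) * (1 + u) by ring]
  exact mul_ne_zero (one_sub_ne_zero hu) (one_add_ne_zero hu)

theorem hasDerivAt_kernel {u : ℂ} (hu : u ∈ kernelDomain) : HasDerivAt kernel (kernel₁ u) u := by
  have hm := one_sub_ne_zero hu
  have hp := one_add_ne_zero hu
  have d1 : HasDerivAt (fun u : ℂ => (1 - u) ^ 2) (2 * (1 - u) * (-1)) u := by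
    simpa using ((hasDerivAt_id u).const_sub 1).fun_pow 2
  have d2 : HasDerivAt (fun u : ℂ => (1 + u) ^ 2) (2 * (1 + u)) u := by
    simpa using ((hasDerivAt_id u).const_add 1).fun_pow 2
  have d3 : HasDerivAt (fun u : ℂ => u ^ 2) (2 * u) u := by
    simpa using (hasDerivAt_id u).fun_pow 2
  refine ((((d1.fun_mul (hasDerivAt_logOneSub hu)).fun_add
    (d2.fun_mul (hasDerivAt_log_one_add hu))).const_mul (-(1 / 4))).fun_add
    (d3.const_mul (3 / 4))).congr_deriv ?_
  rw [kernel₁]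
  field_simp
  ring

theorem hasDerivAt_kernel₁ {u : ℂ} (hu : u ∈ kernelDomain) : HasDerivAt kernel₁ (kernel₂ u) u := by
  have hm := one_sub_ne_zero hu
  have hp := one_add_ne_zero hu
  have d1 : HasDerivAt (fun u : ℂ => 1 - u) (-1) u := (hasDerivAt_id u).const_sub 1
  have d2 : HasDerivAt (fun u : ℂ => 1 + u) 1 u := (hasDerivAt_id u).const_add 1
  refine ((((d1.fun_mul (hasDerivAt_logOneSub hu)).fun_sub
    (d2.fun_mul (hasDerivAt_log_one_add hu))).const_mul (1 / 2)).fun_add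
    (hasDerivAt_id' u)).congr_deriv ?_
  rw [kernel₂]
  field_simp
  ring

theorem hasDerivAt_kernel₂ {u : ℂ} (hu : u ∈ kernelDomain) : HasDerivAt kernel₂ (kernel₃ u) u := by
  have hm := one_sub_ne_zero hu
  have hp := one_add_ne_zero hu
  have h2 := one_sub_sq_ne_zero hu
  refine (((hasDerivAt_logOneSub hu).fun_add
    (hasDerivAt_log_one_add hu)).const_mul (-(1 / 2))).congr_deriv ?_
  rw [kernel₃]
  field_simp
  ring

theorem hasDerivAt_kernel₃ {u : ℂ} (hu : u ∈ kernelDomain) : HasDerivAt kernel₃ (kernel₄ u) u := by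
  have h2 := one_sub_sq_ne_zero hu
  have d3 : HasDerivAt (fun u : ℂ => 1 - u ^ 2) (-(2 * u)) u := by
    simpa using ((hasDerivAt_id u).fun_pow 2).const_sub 1
  refine ((hasDerivAt_id' u).fun_div d3 h2).congr_deriv ?_
  rw [kernel₄]
  field_simp
  ring

theorem zero_mem_kernelDomain : (0 : ℂ) ∈ kernelDomain := Or.inr (by simp)

theorem logOneSub_zero : logOneSub 0 = 0 := by rw [logOneSub_eq (by simp)]; simp

theorem kernel_zero : kernel 0 = 0 := by simp [kernel, logOneSub_zero]
theorem kernel₁_zero : kernel₁ 0 = 0 := by simp [kernel₁, logOneSub_zero]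
theorem kernel₂_zero : kernel₂ 0 = 0 := by simp [kernel₂, logOneSub_zero]
theorem kernel₃_zero : kernel₃ 0 = 0 := by simp [kernel₃]

/-! ### Size of the kernel -/

theorem norm_log_le (z : ℂ) : ‖log z‖ ≤ |Real.log ‖z‖| + 4 := by
  have h1 : log z = (Real.log ‖z‖ : ℂ) + z.arg * I := rfl
  rw [h1]
  refine (norm_add_le _ _).trans ?_
  rw [norm_mul, norm_I, mul_one, norm_real, norm_real, Real.norm_eq_abs, Real.norm_eq_abs]
  linarith [abs_arg_le_pi z, Real.pi_lt_four]

theorem norm_log_le_of_one_le {z : ℂ} (hz : 1 ≤ ‖z‖) : ‖log z‖ ≤ 5 * ‖z‖ := by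
  have h1 := norm_log_le z
  rw [abs_of_nonneg (Real.log_nonneg hz)] at h1
  linarith [Real.log_le_self (norm_nonneg z)]

/-- One factor `z` tames the logarithm at the origin, including the value `log 0 = 0`. This controls
`kernel` at `u = ±1`. -/
theorem norm_mul_log_le (z : ℂ) : ‖z * log z‖ ≤ 1 + 4 * ‖z‖ + ‖z‖ ^ 2 := by
  rcases eq_or_ne z 0 with rfl | h0
  · simp
  have hpos : 0 < ‖z‖ := norm_pos_iff.2 h0
  have h2 : ‖z‖ * |Real.log ‖z‖| ≤ 1 + ‖z‖ ^ 2 := by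
    rcases le_total ‖z‖ 1 with h | h
    · have := Real.abs_log_mul_self_lt ‖z‖ hpos h
      rw [abs_mul, abs_of_pos hpos] at this
      nlinarith
    · rw [abs_of_nonneg (Real.log_nonneg h)]
      nlinarith [Real.log_le_self hpos.le]
  rw [norm_mul]
  nlinarith [norm_log_le z]

theorem norm_logOneSub_le (u : ℂ) : ‖logOneSub u‖ ≤ ‖log (I * (1 - u))‖ + 2 := by
  refine (norm_sub_le _ _).trans ?_
  rw [norm_mul, norm_I, norm_div, norm_real, Real.norm_of_nonneg Real.pi_pos.le]
  norm_num
  linarith [Real.pi_lt_four]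

theorem norm_bounds_of_two_le {u : ℂ} (hu : 2 ≤ ‖u‖) :
    ‖1 - u‖ ≤ 2 * ‖u‖ ∧ ‖1 + u‖ ≤ 2 * ‖u‖ ∧ ‖logOneSub u‖ ≤ 11 * ‖u‖ ∧
      ‖log (1 + u)‖ ≤ 10 * ‖u‖ := by
  have a1 : ‖1 - u‖ ≤ 1 + ‖u‖ := by simpa using norm_sub_le 1 u
  have a2 : ‖1 + u‖ ≤ 1 + ‖u‖ := by simpa using norm_add_le 1 u
  have b1 : ‖u‖ - 1 ≤ ‖1 - u‖ := by
    have := norm_sub_norm_le u 1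
    rw [norm_sub_rev u 1] at this; simpa using this
  have b2 : ‖u‖ - 1 ≤ ‖1 + u‖ := by
    have := norm_sub_norm_le u (-1)
    rw [sub_neg_eq_add, add_comm u 1] at this; simpa using this
  have c1 := norm_log_le_of_one_le (z := 1 + u) (by linarith)
  have c2 := norm_log_le_of_one_le (z := I * (1 - u)) (by rw [norm_mul, norm_I]; linarith)
  rw [norm_mul, norm_I, one_mul] at c2
  have c3 := norm_logOneSub_le u
  refine ⟨by linarith, by linarith, by linarith, by linarith⟩

theorem norm_kernel_le_of_two_le {u : ℂ} (hu : 2 ≤ ‖u‖) : ‖kernel u‖ ≤ 30 * ‖u‖ ^ 3 := by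
  obtain ⟨a1, a2, a3, a4⟩ := norm_bounds_of_two_le hu
  calc ‖kernel u‖ ≤ 1 / 4 * (‖1 - u‖ ^ 2 * ‖logOneSub u‖ + ‖1 + u‖ ^ 2 * ‖log (1 + u)‖)
        + 3 / 4 * ‖u‖ ^ 2 := by
        rw [kernel]
        refine (norm_add_le _ _).trans (add_le_add ?_ (by simp))
        rw [norm_mul]
        refine mul_le_mul (by simp) ((norm_add_le _ _).trans (by simp)) (norm_nonneg _) (by norm_num)
    _ ≤ 1 / 4 * ((2 * ‖u‖) ^ 2 * (11 * ‖u‖) + (2 * ‖u‖) ^ 2 * (10 * ‖u‖)) + 3 / 4 * ‖u‖ ^ 2 := by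
        gcongr
    _ ≤ 30 * ‖u‖ ^ 3 := by nlinarith [pow_two_nonneg ‖u‖]

theorem norm_kernel₁_le_of_two_le {u : ℂ} (hu : 2 ≤ ‖u‖) : ‖kernel₁ u‖ ≤ 30 * ‖u‖ ^ 3 := by
  obtain ⟨a1, a2, a3, a4⟩ := norm_bounds_of_two_le hu
  calc ‖kernel₁ u‖ ≤ 1 / 2 * (‖1 - u‖ * ‖logOneSub u‖ + ‖1 + u‖ * ‖log (1 + u)‖) + ‖u‖ := by
        rw [kernel₁]
        refine (norm_add_le _ _).trans (add_le_add ?_ le_rfl)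
        rw [norm_mul]
        refine mul_le_mul (by simp) ((norm_sub_le _ _).trans (by simp)) (norm_nonneg _) (by norm_num)
    _ ≤ 1 / 2 * ((2 * ‖u‖) * (11 * ‖u‖) + (2 * ‖u‖) * (10 * ‖u‖)) + ‖u‖ := by gcongr
    _ ≤ 30 * ‖u‖ ^ 3 := by nlinarith [pow_two_nonneg ‖u‖]

theorem norm_kernel₂_le_of_two_le {u : ℂ} (hu : 2 ≤ ‖u‖) : ‖kernel₂ u‖ ≤ 30 * ‖u‖ ^ 3 := by
  obtain ⟨a1, a2, a3, a4⟩ := norm_bounds_of_two_le hu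
  calc ‖kernel₂ u‖ ≤ 1 / 2 * (‖logOneSub u‖ + ‖log (1 + u)‖) := by
        rw [kernel₂, norm_mul]
        exact mul_le_mul (by simp) (norm_add_le _ _) (norm_nonneg _) (by norm_num)
    _ ≤ 1 / 2 * (11 * ‖u‖ + 10 * ‖u‖) := by gcongr
    _ ≤ 30 * ‖u‖ ^ 3 := by nlinarith [pow_two_nonneg ‖u‖]

theorem norm_kernel₃_le_of_two_le {u : ℂ} (hu : 2 ≤ ‖u‖) : ‖kernel₃ u‖ ≤ 30 * ‖u‖ ^ 3 := by
  have h : 1 ≤ ‖1 - u ^ 2‖ := by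
    have := norm_sub_norm_le (u ^ 2) 1
    rw [norm_sub_rev, norm_one, norm_pow] at this
    nlinarith
  rw [kernel₃, norm_div]
  refine (div_le_self (norm_nonneg _) h).trans ?_
  nlinarith [pow_two_nonneg ‖u‖]

/-- For `‖u‖ ≥ 2` the cubic bound suffices. On the annulus between `1/2` and `2`, `z² log z` is
bounded even at the branch points, and `‖u‖⁴ ≥ 1/16` absorbs the constants. -/
theorem norm_kernel_le_of_half_le {u : ℂ} (hu : 1 / 2 ≤ ‖u‖) : ‖kernel u‖ ≤ 1000 * ‖u‖ ^ 4 := by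
  rcases le_total 2 ‖u‖ with h2 | h2
  · have := norm_kernel_le_of_two_le h2
    have h3 : 0 ≤ ‖u‖ ^ 3 := by positivity
    nlinarith [mul_le_mul_of_nonneg_right h2 h3]
  have a1 : ‖1 - u‖ ≤ 3 := by
    have : ‖1 - u‖ ≤ 1 + ‖u‖ := by simpa using norm_sub_le 1 u
    linarith
  have a2 : ‖1 + u‖ ≤ 3 := by
    have : ‖1 + u‖ ≤ 1 + ‖u‖ := by simpa using norm_add_le 1 u
    linarith
  have key : ∀ z : ℂ, ‖z‖ ≤ 3 → ‖z ^ 2 * log z‖ ≤ 66 := by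
    intro z hz
    rw [sq, mul_assoc, norm_mul]
    have := norm_mul_log_le z
    calc ‖z‖ * ‖z * log z‖ ≤ 3 * 22 := by
          refine mul_le_mul hz ?_ (norm_nonneg _) (by norm_num)
          nlinarith [norm_nonneg z]
      _ = 66 := by norm_num
  have k1 := key (1 + u) a2
  have k2 := key (I * (1 - u)) (by simpa using a1)
  have hrw : kernel u = 1 / 4 * ((I * (1 - u)) ^ 2 * log (I * (1 - u)))
      + (1 / 4 * (Real.pi / 2 * I)) * (1 - u) ^ 2 - 1 / 4 * ((1 + u) ^ 2 * log (1 + u))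
      + 3 / 4 * u ^ 2 := by
    rw [kernel, logOneSub, mul_pow, I_sq]; ring
  have hpi : ‖(1 / 4 * (Real.pi / 2 * I) : ℂ)‖ ≤ 1 / 2 := by
    simp only [norm_mul, norm_div, norm_I, norm_real, Real.norm_of_nonneg Real.pi_pos.le]
    norm_num
    linarith [Real.pi_lt_four]
  have hb : ‖kernel u‖ ≤ 1 / 4 * 66 + 1 / 2 * 3 ^ 2 + 1 / 4 * 66 + 3 / 4 * 2 ^ 2 := by
    rw [hrw]
    refine (norm_add_le _ _).trans (add_le_add ((norm_sub_le _ _).trans (add_le_add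
      ((norm_add_le _ _).trans (add_le_add ?_ ?_)) ?_)) ?_)
    · rw [norm_mul]; gcongr; simp
    · rw [norm_mul, norm_pow]; gcongr
    · rw [norm_mul]; gcongr; simp
    · rw [norm_mul, norm_pow]; norm_num
      have : ‖u‖ ^ 2 ≤ 2 ^ 2 := by gcongr
      linarith
  have : (1 / 2 : ℝ) ^ 4 ≤ ‖u‖ ^ 4 := by gcongr
  norm_num at this hb
  linarith

/-! ### The power series of the kernel -/

theorem kernelCoeff_eq_zero {k : ℕ} (hk : k < 4) : kernelCoeff k = 0 := by
  interval_cases k <;> (simp [kernelCoeff]; try decide)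

theorem kernelCoeff_nonneg (k : ℕ) : 0 ≤ kernelCoeff k := by
  rcases lt_or_ge k 4 with h | h
  · rw [kernelCoeff_eq_zero h]
  · have : (4 : ℝ) ≤ k := by exact_mod_cast h
    rw [kernelCoeff]; split_ifs
    · exact inv_nonneg.2 (mul_nonneg (mul_nonneg (by linarith) (by linarith)) (by linarith))
    · rfl

theorem kernelCoeff_le_one (k : ℕ) : kernelCoeff k ≤ 1 := by
  rcases lt_or_ge k 4 with h | h
  · rw [kernelCoeff_eq_zero h]; norm_num
  · have : (4 : ℝ) ≤ k := by exact_mod_cast h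
    rw [kernelCoeff]; split_ifs
    · refine inv_le_one_of_one_le₀ ?_
      have h1 : (1 : ℝ) ≤ k * (k - 1) := by nlinarith
      nlinarith
    · norm_num

theorem norm_kernelCoeff_mul_pow_le (k : ℕ) (u : ℂ) :
    ‖(kernelCoeff k : ℂ) * u ^ k‖ ≤ ‖u‖ ^ k := by
  rw [norm_mul, norm_pow, norm_real, Real.norm_of_nonneg (kernelCoeff_nonneg k)]
  exact mul_le_of_le_one_left (by positivity) (kernelCoeff_le_one k)

theorem HasSum.congr_of_eq {f g : ℕ → ℂ} {a b : ℂ} (h : HasSum g b) (hf : ∀ k, f k = g k)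
    (hab : a = b) : HasSum f a := by
  rw [funext hf, hab]; exact h

/-- The coefficients of `-(1 - v)² log(1 - v)` are second differences of `1/n`, that is
`2/((k+1)(k+2)(k+3))` at `v^(k+3)`. Adding the values at `v = u` and `v = -u` removes the odd
powers. -/
theorem hasSum_kernel {u : ℂ} (hu : ‖u‖ < 1) :
    HasSum (fun k : ℕ => (kernelCoeff k : ℂ) * u ^ k) (kernel u) := by
  have hre : u.re < 1 := (le_abs_self _).trans_lt ((abs_re_le_norm u).trans_lt hu)
  have hsum : ∀ v : ℂ, ‖v‖ < 1 → HasSum (fun k : ℕ => v ^ (k + 3) *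
      (((k : ℂ) + 3)⁻¹ - 2 * ((k : ℂ) + 2)⁻¹ + ((k : ℂ) + 1)⁻¹))
      ((1 - v) ^ 2 * (-log (1 - v)) - v + 3 / 2 * v ^ 2) := by
    intro v hv
    have h1 := hasSum_taylorSeries_neg_log' hv
    have h2 := (hasSum_nat_add_iff' 1).2 h1
    have h3 := (hasSum_nat_add_iff' 2).2 h1
    -- Dropping two, one and no initial terms aligns the three products of `(1 - v)² = 1 - 2v + v²`
    -- at the same power `v^(k+3)`.
    have := (h3.add (h2.mul_left (-2 * v))).add (h1.mul_left (v ^ 2))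
    refine HasSum.congr_of_eq this (fun k => ?_) ?_
    · push_cast
      have e1 : (k : ℂ) + 2 + 1 = k + 3 := by ring
      have e2 : (k : ℂ) + 1 + 1 = k + 2 := by ring
      rw [e1, e2]
      simp only [div_eq_mul_inv]
      ring
    · simp [Finset.sum_range_succ]
      ring
  have hp := hsum u hu
  have hm := hsum (-u) (by simpa using hu)
  have h := (hp.add hm).mul_left (1 / 4)
  rw [← hasSum_nat_add_iff' 3]
  refine HasSum.congr_of_eq h (fun k => ?_) ?_
  · rw [neg_pow u, kernelCoeff]
    have e0 : (k : ℂ) + 3 ≠ 0 := by exact_mod_cast (by positivity : (k : ℝ) + 3 ≠ 0)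
    have e1 : (k : ℂ) + 2 ≠ 0 := by exact_mod_cast (by positivity : (k : ℝ) + 2 ≠ 0)
    have e2 : (k : ℂ) + 1 ≠ 0 := by exact_mod_cast (by positivity : (k : ℝ) + 1 ≠ 0)
    split_ifs with hev
    · rw [hev.neg_one_pow]
      push_cast
      rw [show (k : ℂ) + 3 - 1 = k + 2 by ring, show (k : ℂ) + 3 - 2 = k + 1 by ring]
      field_simp
      ring
    · rw [(Nat.not_even_iff_odd.1 hev).neg_one_pow]
      push_cast
      ring
  · simp only [Finset.sum_range_succ, Finset.sum_range_zero, kernelCoeff_eq_zero (show 0 < 4 by norm_num),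
      kernelCoeff_eq_zero (show 1 < 4 by norm_num), kernelCoeff_eq_zero (show 2 < 4 by norm_num)]
    rw [kernel, logOneSub_eq hre, sub_neg_eq_add]
    push_cast
    ring_nf

/-- The Taylor bound persists beyond the radius of convergence, as Watson's lemma needs on all of
the positive axis. Near `0` it is a geometric tail; for `‖u‖ ≥ 1/2` every lower power is at most
`(2‖u‖)^M`. -/
theorem norm_kernel_sub_sum_le {M : ℕ} (hM : 4 ≤ M) (u : ℂ) :
    ‖kernel u - ∑ k ∈ Finset.range M, (kernelCoeff k : ℂ) * u ^ k‖
      ≤ ((1000 + M) * 2 ^ M) * ‖u‖ ^ M := by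
  have h2M : (1 : ℝ) ≤ 2 ^ M := one_le_pow₀ (by norm_num)
  rcases lt_or_ge ‖u‖ (1 / 2) with h | h
  · have hs := (hasSum_nat_add_iff' M).2 (hasSum_kernel (u := u) (by linarith))
    have hg := (hasSum_geometric_of_lt_one (norm_nonneg u) (by linarith)).mul_left (‖u‖ ^ M)
    have hle : ‖kernel u - ∑ k ∈ Finset.range M, (kernelCoeff k : ℂ) * u ^ k‖
        ≤ ‖u‖ ^ M * (1 - ‖u‖)⁻¹ := by
      rw [← hs.tsum_eq]
      refine tsum_of_norm_bounded hg fun k => ?_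
      rw [← pow_add, add_comm M k]
      exact norm_kernelCoeff_mul_pow_le _ _
    have h3 : (1 - ‖u‖)⁻¹ ≤ 2 := by
      rw [inv_le_comm₀ (by linarith) (by norm_num)]; norm_num; linarith
    have h4 : (2 : ℝ) ≤ (1000 + M) * 2 ^ M := by
      have : (0 : ℝ) ≤ M := M.cast_nonneg
      nlinarith
    calc _ ≤ ‖u‖ ^ M * (1 - ‖u‖)⁻¹ := hle
      _ ≤ ‖u‖ ^ M * ((1000 + M) * 2 ^ M) := by gcongr; linarith
      _ = _ := mul_comm _ _
  · have h1 : 1 ≤ 2 * ‖u‖ := by linarith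
    have hpow : ∀ k, k ≤ M → ‖u‖ ^ k ≤ 2 ^ M * ‖u‖ ^ M := by
      intro k hk
      calc ‖u‖ ^ k ≤ (2 * ‖u‖) ^ k := by gcongr; linarith [norm_nonneg u]
        _ ≤ (2 * ‖u‖) ^ M := pow_le_pow_right₀ h1 hk
        _ = _ := mul_pow _ _ _
    calc _ ≤ ‖kernel u‖ + ∑ k ∈ Finset.range M, ‖(kernelCoeff k : ℂ) * u ^ k‖ :=
          (norm_sub_le _ _).trans (by gcongr; exact norm_sum_le _ _)
      _ ≤ 1000 * (2 ^ M * ‖u‖ ^ M) + ∑ k ∈ Finset.range M, 2 ^ M * ‖u‖ ^ M := by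
          gcongr with k hk
          · exact (norm_kernel_le_of_half_le h).trans (by gcongr; exact hpow 4 hM)
          · exact (norm_kernelCoeff_mul_pow_le _ _).trans (hpow k (Finset.mem_range.1 hk).le)
      _ = _ := by rw [Finset.sum_const, Finset.card_range, nsmul_eq_mul]; ring

theorem exists_norm_kernel_le : ∃ C : ℝ, 0 < C ∧ ∀ u : ℂ, ‖kernel u‖ ≤ C * ‖u‖ ^ 4 := by
  refine ⟨(1000 + (4 : ℕ)) * 2 ^ 4, by norm_num, fun u => ?_⟩
  have h := norm_kernel_sub_sum_le (M := 4) le_rfl u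
  rw [Finset.sum_eq_zero, sub_zero] at h
  · exact h
  · intro k hk
    rw [kernelCoeff_eq_zero (Finset.mem_range.1 hk)]; simp

/-! ### Continuity of the kernel up to the boundary -/

/-- The closed right half-plane meets the cut only at `0`, where `z²` beats the logarithm. -/
theorem continuousOn_sq_mul_log : ContinuousOn (fun z : ℂ => z ^ 2 * log z) {z | 0 ≤ z.re} := by
  intro z hz
  rcases eq_or_ne z 0 with rfl | h0
  · refine ContinuousAt.continuousWithinAt ?_
    rw [ContinuousAt, zero_pow two_ne_zero, zero_mul]
    refine squeeze_zero_norm (a := fun z : ℂ => ‖z‖ * (1 + 4 * ‖z‖ + ‖z‖ ^ 2)) (fun z => ?_) ?_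
    · rw [sq, mul_assoc, norm_mul]
      exact mul_le_mul_of_nonneg_left (norm_mul_log_le z) (norm_nonneg z)
    · have : Continuous fun z : ℂ => ‖z‖ * (1 + 4 * ‖z‖ + ‖z‖ ^ 2) := by fun_prop
      simpa using this.tendsto 0
  · have hs : z ∈ slitPlane := by
      rcases lt_or_eq_of_le (show 0 ≤ z.re from hz) with h | h
      · exact Or.inl h
      · exact Or.inr fun hi => h0 (Complex.ext h.symm hi)
    exact ((continuousAt_id.pow 2).mul (continuousAt_clog hs)).continuousWithinAt

theorem continuousOn_kernel : ContinuousOn kernel {u | 0 ≤ u.im ∧ 0 ≤ u.re} := by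
  have hrw : kernel = fun u => 1 / 4 * ((I * (1 - u)) ^ 2 * log (I * (1 - u)))
      + (1 / 4 * (Real.pi / 2 * I)) * (1 - u) ^ 2 - 1 / 4 * ((1 + u) ^ 2 * log (1 + u))
      + 3 / 4 * u ^ 2 := by
    ext u
    rw [kernel, logOneSub, mul_pow, I_sq]; ring
  have h1 : ContinuousOn (fun u : ℂ => (I * (1 - u)) ^ 2 * log (I * (1 - u)))
      {u | 0 ≤ u.im ∧ 0 ≤ u.re} :=
    continuousOn_sq_mul_log.comp (f := fun u : ℂ => I * (1 - u)) (by fun_prop) fun u hu => by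
      simpa using hu.1
  have h2 : ContinuousOn (fun u : ℂ => (1 + u) ^ 2 * log (1 + u)) {u | 0 ≤ u.im ∧ 0 ≤ u.re} :=
    continuousOn_sq_mul_log.comp (f := fun u : ℂ => 1 + u) (by fun_prop) fun u hu => by
      have := hu.2
      simp only [Set.mem_ofPred_eq, add_re, one_re]
      linarith
  rw [hrw]
  exact (((h1.const_mul _).add (by fun_prop)).sub (h2.const_mul _)).add (by fun_prop)

/-! ### Rotation of the Laplace integral of the kernel -/

/-- The Laplace integral of `kernel` along the ray with direction `d`. -/
def rayLaplace (p d : ℂ) : ℂ := d * ∫ s in Set.Ioi (0 : ℝ), kernel (d * s) * cexp (-(p * d * s))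

/-- The directions in the upper half-plane along which the Laplace integral converges. -/
def rayDomain (p : ℂ) : Set ℂ := {d | 0 < d.im ∧ 0 < (p * d).re}

theorem mul_ofReal_mem_kernelDomain {d : ℂ} (hd : 0 < d.im) {s : ℝ} (hs : 0 < s) :
    d * s ∈ kernelDomain := by
  left
  simpa using mul_pos hd hs

theorem continuousOn_kernel_ray {d : ℂ} (hd : 0 < d.im) :
    ContinuousOn (fun s : ℝ => kernel (d * s)) (Set.Ioi 0) := by
  intro s hs
  have h1 := (hasDerivAt_kernel (mul_ofReal_mem_kernelDomain hd hs)).continuousAt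
  have h2 : ContinuousAt (fun s : ℝ => d * (s : ℂ)) s := by fun_prop
  exact (ContinuousAt.comp (f := fun s : ℝ => d * (s : ℂ)) h1 h2).continuousWithinAt

theorem aestronglyMeasurable_ray {d : ℂ} (hd : 0 < d.im) (p : ℂ) :
    AEStronglyMeasurable (fun s : ℝ => kernel (d * s) * cexp (-(p * s)))
      (volume.restrict (Set.Ioi 0)) := by
  refine ContinuousOn.aestronglyMeasurable ?_ measurableSet_Ioi
  exact (continuousOn_kernel_ray hd).mul (by fun_prop)

theorem norm_ray_le {C : ℝ} (hC : ∀ u : ℂ, ‖kernel u‖ ≤ C * ‖u‖ ^ 4) (hC0 : 0 < C) {d p : ℂ}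
    {M c s : ℝ} (hM : ‖d‖ ≤ M) (hc : c ≤ p.re) (hs : 0 < s) :
    ‖kernel (d * s) * cexp (-(p * s))‖ ≤ C * M ^ 4 * (s ^ 4 * Real.exp (-(c * s))) := by
  rw [norm_mul, norm_cexp_neg_mul]
  have h1 := hC (d * s)
  rw [norm_mul, norm_real, Real.norm_of_nonneg hs.le, mul_pow] at h1
  calc _ ≤ (C * (‖d‖ ^ 4 * s ^ 4)) * Real.exp (-(c * s)) := by gcongr
    _ ≤ (C * (M ^ 4 * s ^ 4)) * Real.exp (-(c * s)) := by gcongr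
    _ = _ := by ring

theorem differentiableAt_rayLaplace {p d : ℂ} (hd : d ∈ rayDomain p) :
    DifferentiableAt ℂ (rayLaplace p) d := by
  obtain ⟨hd1, hd2⟩ := hd
  obtain ⟨C, hC0, hC⟩ := exists_norm_kernel_le
  set c := (p * d).re / 2 with hc
  have hc0 : 0 < c := half_pos hd2
  have hopen : IsOpen {z : ℂ | 0 < z.im ∧ c < (p * z).re ∧ ‖z‖ < ‖d‖ + 1} :=
    (isOpen_lt continuous_const continuous_im).inter
      ((isOpen_lt continuous_const (by fun_prop : Continuous fun z : ℂ => (p * z).re)).inter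
        (isOpen_lt continuous_norm continuous_const))
  obtain ⟨r, hr, hball⟩ := Metric.isOpen_iff.1 hopen d ⟨hd1, by linarith, by linarith⟩
  refine differentiableAt_id.mul (differentiableAt_integral_of_dominated
    (F := fun z (s : ℝ) => kernel (z * s) * cexp (-(p * z * s)))
    (b := fun s => C * (‖d‖ + 1) ^ 4 * (s ^ 4 * Real.exp (-(c * s)))) hr ?_ ?_ ?_ ?_)
  · intro z hz
    exact aestronglyMeasurable_ray (hball hz).1 (p * z)
  · filter_upwards [ae_restrict_mem measurableSet_Ioi] with s hs z hz
    have h1 := (hasDerivAt_kernel (mul_ofReal_mem_kernelDomain (hball hz).1 hs)).differentiableAt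
    have h2 : DifferentiableAt ℂ (fun z : ℂ => z * (s : ℂ)) z := by fun_prop
    exact ((DifferentiableAt.fun_comp' (f := fun z : ℂ => z * (s : ℂ)) z h1 h2).mul
      (by fun_prop)).differentiableWithinAt
  · filter_upwards [ae_restrict_mem measurableSet_Ioi] with s hs z hz
    obtain ⟨_, h2, h3⟩ := hball hz
    exact norm_ray_le hC hC0 h3.le h2.le hs
  · exact (integrableOn_pow_mul_exp_neg_mul 4 hc0).const_mul _

theorem rayLaplace_real_mul (p d : ℂ) {l : ℝ} (hl : 0 < l) :
    rayLaplace p (l * d) = rayLaplace p d := by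
  have h := integral_comp_mul_left_Ioi' (fun s : ℝ => kernel (d * s) * cexp (-(p * d * s))) 0 hl
  rw [mul_zero] at h
  rw [rayLaplace, rayLaplace, ← h, real_smul, mul_comm (l : ℂ) d, mul_assoc]
  congr 2
  refine setIntegral_congr_fun measurableSet_Ioi fun s _ => ?_
  simp only [ofReal_mul]
  rw [show d * ↑l * (s : ℂ) = d * (l * s) by ring,
    show p * (d * ↑l) * (s : ℂ) = p * d * (l * s) by ring]

/-- Positive dilations of `d` do not change the integral, so the radial derivative `d · f'(d)`
vanishes, and with it the complex derivative. This replaces a contour shift with arcs at infinity.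
-/
theorem deriv_rayLaplace {p d : ℂ} (hd : d ∈ rayDomain p) : deriv (rayLaplace p) d = 0 := by
  have hd0 : d ≠ 0 := by
    rintro rfl
    simpa using hd.1
  have h1 : HasDerivAt (rayLaplace p) (deriv (rayLaplace p) d) (((1 : ℝ) : ℂ) * d) := by
    rw [ofReal_one, one_mul]
    exact (differentiableAt_rayLaplace hd).hasDerivAt
  have h2 : HasDerivAt (fun t : ℝ => (t : ℂ) * d) d 1 := by
    simpa using (hasDerivAt_id (1 : ℝ)).ofReal_comp.mul_const d
  have h3 := HasDerivAt.comp (h := fun t : ℝ => (t : ℂ) * d) (1 : ℝ) h1 h2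
  have h4 : (rayLaplace p ∘ fun t : ℝ => (t : ℂ) * d) =ᶠ[𝓝 1] fun _ => rayLaplace p d := by
    filter_upwards [lt_mem_nhds (show (0 : ℝ) < 1 by norm_num)] with t ht
    exact rayLaplace_real_mul p d ht
  have h5 := (hasDerivAt_const (1 : ℝ) (rayLaplace p d)).congr_of_eventuallyEq h4
  have := h3.unique h5
  simpa [hd0] using this

theorem isOpen_rayDomain (p : ℂ) : IsOpen (rayDomain p) :=
  (isOpen_lt continuous_const continuous_im).inter
    (isOpen_lt continuous_const (by fun_prop : Continuous fun d : ℂ => (p * d).re))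

theorem convex_rayDomain (p : ℂ) : Convex ℝ (rayDomain p) := by
  intro x hx y hy a b ha hb hab
  obtain ⟨hx1, hx2⟩ := hx
  obtain ⟨hy1, hy2⟩ := hy
  have key : ∀ u v : ℝ, 0 < u → 0 < v → 0 < a * u + b * v := by
    intro u v hu hv
    rcases lt_or_eq_of_le ha with h | h
    · have := mul_pos h hu
      have := mul_nonneg hb hv.le
      linarith
    · have : b = 1 := by linarith
      simp [← h, this, hv]
  refine ⟨?_, ?_⟩
  · simpa using key _ _ hx1 hy1
  · have := key _ _ hx2 hy2
    simp only [real_smul, mul_add] at this ⊢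
    rw [add_re, show p * ((a : ℂ) * x) = a * (p * x) by ring,
      show p * ((b : ℂ) * y) = b * (p * y) by ring, re_ofReal_mul, re_ofReal_mul]
    exact this

theorem rayLaplace_eq_rayLaplace {p d e : ℂ} (hd : d ∈ rayDomain p) (he : e ∈ rayDomain p) :
    rayLaplace p d = rayLaplace p e :=
  (isOpen_rayDomain p).is_const_of_deriv_eq_zero (convex_rayDomain p).isPreconnected
    (fun _ hx => (differentiableAt_rayLaplace hx).differentiableWithinAt)
    (fun _ hx => deriv_rayLaplace hx) hd he

theorem continuousOn_kernel_ofReal : ContinuousOn (fun s : ℝ => kernel s) (Set.Ici 0) :=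
  continuousOn_kernel.comp (by fun_prop) fun s hs => by simpa using hs

/-- The real direction is on the boundary of `rayDomain`. It is reached from above by dominated
convergence, using the quartic bound and continuity of `kernel` up to the axis. -/
theorem tendsto_rayLaplace_one {p : ℂ} (hp : 0 < p.re) :
    Tendsto (fun ε : ℝ => rayLaplace p (1 + ε * I)) (𝓝[>] 0)
      (𝓝 (∫ s in Set.Ioi (0 : ℝ), kernel s * cexp (-(p * s)))) := by
  obtain ⟨C, hC0, hC⟩ := exists_norm_kernel_le
  have hd : Tendsto (fun ε : ℝ => (1 + ε * I : ℂ)) (𝓝[>] 0) (𝓝 1) := by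
    have : Continuous fun ε : ℝ => (1 + ε * I : ℂ) := by fun_prop
    simpa using (this.tendsto 0).mono_left nhdsWithin_le_nhds
  have hev : ∀ᶠ ε : ℝ in 𝓝[>] 0, p.re / 2 < (p * (1 + ε * I)).re ∧ ‖(1 + ε * I : ℂ)‖ < 2 := by
    have h1 : Tendsto (fun ε : ℝ => (p * (1 + ε * I)).re) (𝓝[>] 0) (𝓝 p.re) := by
      have : Continuous fun ε : ℝ => (p * (1 + ε * I)).re := by fun_prop
      simpa using (this.tendsto 0).mono_left nhdsWithin_le_nhds
    have h2 := hd.norm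
    rw [norm_one] at h2
    exact (h1.eventually (lt_mem_nhds (by linarith))).and (h2.eventually (gt_mem_nhds (by norm_num)))
  rw [← one_mul (∫ s in Set.Ioi (0 : ℝ), kernel s * cexp (-(p * s)))]
  refine hd.mul (tendsto_integral_filter_of_dominated_convergence
    (fun s => C * 2 ^ 4 * (s ^ 4 * Real.exp (-(p.re / 2 * s)))) ?_ ?_ ?_ ?_)
  · filter_upwards [self_mem_nhdsWithin] with ε hε
    exact aestronglyMeasurable_ray (d := 1 + ε * I) (by simpa using hε) _
  · filter_upwards [hev] with ε hε
    filter_upwards [ae_restrict_mem measurableSet_Ioi] with s hs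
    exact norm_ray_le hC hC0 hε.2.le hε.1.le hs
  · exact (integrableOn_pow_mul_exp_neg_mul 4 (half_pos hp)).const_mul _
  · filter_upwards [ae_restrict_mem measurableSet_Ioi] with s hs
    refine Tendsto.mul ?_ ?_
    · have hs0 : (0 : ℝ) < s := hs
      have h1 : ContinuousWithinAt kernel {u | 0 ≤ u.im ∧ 0 ≤ u.re} (s : ℂ) :=
        continuousOn_kernel _ (by simpa using hs0.le)
      refine h1.tendsto.comp (tendsto_nhdsWithin_iff.2 ⟨?_, ?_⟩)
      · simpa using hd.mul_const (s : ℂ)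
      · filter_upwards [self_mem_nhdsWithin] with ε hε
        have hε0 : (0 : ℝ) < ε := hε
        refine ⟨?_, ?_⟩
        · simpa using (mul_pos hε0 hs0).le
        · simpa using hs0.le
    · have : Continuous fun ε : ℝ => cexp (-(p * (1 + ε * I) * s)) := by fun_prop
      simpa using (this.tendsto 0).mono_left nhdsWithin_le_nhds

theorem rayLaplace_eq {p d : ℂ} (hp : 0 < p.re) (hd : d ∈ rayDomain p) :
    rayLaplace p d = ∫ s in Set.Ioi (0 : ℝ), kernel s * cexp (-(p * s)) := by
  refine tendsto_nhds_unique (tendsto_const_nhds (x := rayLaplace p d) (f := 𝓝[>] (0 : ℝ)))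
    ((tendsto_rayLaplace_one hp).congr' ?_)
  have h1 : Tendsto (fun ε : ℝ => (p * (1 + ε * I)).re) (𝓝[>] 0) (𝓝 p.re) := by
    have : Continuous fun ε : ℝ => (p * (1 + ε * I)).re := by fun_prop
    simpa using (this.tendsto 0).mono_left nhdsWithin_le_nhds
  filter_upwards [self_mem_nhdsWithin, h1.eventually (lt_mem_nhds hp)] with ε hε h2
  exact rayLaplace_eq_rayLaplace ⟨by simpa using hε, h2⟩ hd

/-! ### Integration by parts along an interior ray -/

theorem kernel₄_I_mul (a : ℂ) (s : ℝ) :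
    kernel₄ (I * a * s) = (1 - a ^ 2 * (s : ℂ) ^ 2) / (1 + a ^ 2 * (s : ℂ) ^ 2) ^ 2 := by
  have : (I * a * s) ^ 2 = -(a ^ 2 * (s : ℂ) ^ 2) := by
    rw [mul_pow, mul_pow, I_sq]; ring
  rw [kernel₄, this, sub_neg_eq_add, ← sub_eq_add_neg]

/-- Decay of order `s⁻²` along the ray, with a constant depending only on the aperture of `a`; no
exponential damping is needed for integrability. -/
theorem norm_kernel₄_le {a : ℂ} (ha : 0 < a.re) (s : ℝ) :
    ‖kernel₄ (I * a * s)‖ ≤ (2 * ‖a‖ ^ 2 / a.re ^ 2) ^ 2 * (1 + (‖a‖ * s) ^ 2)⁻¹ := by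
  have hn : 0 < ‖a‖ := norm_pos_iff.2 (by rintro rfl; simp at ha)
  have h1 := norm_one_add_sq_mul_sq_ge ha s
  have h2 : ‖1 - a ^ 2 * (s : ℂ) ^ 2‖ ≤ 1 + ‖a‖ ^ 2 * s ^ 2 := by
    refine (norm_sub_le _ _).trans ?_
    simp
  have h3 : 0 < a.re ^ 2 / (2 * ‖a‖ ^ 2) * (1 + ‖a‖ ^ 2 * s ^ 2) := by positivity
  rw [kernel₄_I_mul, norm_div, norm_pow]
  calc _ ≤ (1 + ‖a‖ ^ 2 * s ^ 2) / (a.re ^ 2 / (2 * ‖a‖ ^ 2) * (1 + ‖a‖ ^ 2 * s ^ 2)) ^ 2 := by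
        gcongr
    _ = _ := by
        rw [mul_pow ‖a‖ s]
        have : 1 + ‖a‖ ^ 2 * s ^ 2 ≠ 0 := by positivity
        field_simp

theorem integrable_inv_one_add_mul_sq {c : ℝ} (hc : c ≠ 0) :
    Integrable fun s : ℝ => (1 + (c * s) ^ 2)⁻¹ :=
  integrable_inv_one_add_sq.comp_mul_left' hc

theorem one_add_sq_mul_sq_ne_zero {a : ℂ} (ha : 0 < a.re) (s : ℝ) :
    1 + a ^ 2 * (s : ℂ) ^ 2 ≠ 0 := by
  have hn : 0 < ‖a‖ := norm_pos_iff.2 (by rintro rfl; simp at ha)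
  have h1 := norm_one_add_sq_mul_sq_ge ha s
  have h3 : 0 < a.re ^ 2 / (2 * ‖a‖ ^ 2) * (1 + ‖a‖ ^ 2 * s ^ 2) := by positivity
  exact norm_pos_iff.1 (h3.trans_le h1)

theorem continuous_kernel₄_ray {a : ℂ} (ha : 0 < a.re) :
    Continuous fun s : ℝ => kernel₄ (I * a * s) := by
  simp only [kernel₄_I_mul]
  exact Continuous.div (by fun_prop) (by fun_prop)
    fun s => pow_ne_zero 2 (one_add_sq_mul_sq_ne_zero ha s)

theorem integrable_kernel₄_ray_mul {a : ℂ} (ha : 0 < a.re) {q : ℂ} (hq : 0 ≤ q.re) :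
    IntegrableOn (fun s : ℝ => kernel₄ (I * a * s) * cexp (-(q * s))) (Set.Ioi 0) := by
  have hn : ‖a‖ ≠ 0 := norm_ne_zero_iff.2 (by rintro rfl; simp at ha)
  refine ((integrable_inv_one_add_mul_sq hn).const_mul
    ((2 * ‖a‖ ^ 2 / a.re ^ 2) ^ 2)).integrableOn.mono' ?_ ?_
  · exact ((continuous_kernel₄_ray ha).mul (by fun_prop)).aestronglyMeasurable
  · filter_upwards [ae_restrict_mem measurableSet_Ioi] with s hs
    have hs0 : (0 : ℝ) < s := hs
    rw [norm_mul, norm_cexp_neg_mul]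
    refine (mul_le_of_le_one_right (norm_nonneg _) ?_).trans (norm_kernel₄_le ha s)
    rw [Real.exp_le_one_iff]
    nlinarith [mul_nonneg hq hs0.le]

/-- Trades the growing `kernel` for its integrable fourth derivative, so that the damping `Re q` can
afterwards tend to `0`. -/
theorem integral_kernel_eq_integral_kernel₄ {w q : ℂ} (hq : 0 < q.re) (hwq : 0 < (w * q).im) :
    ∫ s in Set.Ioi (0 : ℝ), kernel (w * q * s) * cexp (-(q * s))
      = w ^ 4 * ∫ s in Set.Ioi (0 : ℝ), kernel₄ (w * q * s) * cexp (-(q * s)) := by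
  obtain ⟨C, hC0, hC⟩ := exists_norm_kernel_le
  set μ := w * q with hμ
  have hμ0 : 0 < ‖μ‖ := norm_pos_iff.2 (by intro h; rw [h] at hwq; simp at hwq)
  have hq0 : q ≠ 0 := by rintro rfl; simp at hq
  set a := -I * μ with ha
  have hare : 0 < a.re := by simpa [ha] using hwq
  have haμ : I * a = μ := by rw [ha, ← mul_assoc]; simp
  have hi1 : IntegrableOn (fun s : ℝ => kernel (μ * s) * cexp (-(q * s))) (Set.Ioi 0) :=
    integrableOn_of_norm_le_pow_mul_exp hq (aestronglyMeasurable_ray hwq q)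
      fun t ht => norm_ray_le hC hC0 le_rfl le_rfl ht
  have hi4 := integrable_kernel₄_ray_mul hare hq.le
  rw [haμ] at hi4
  have hμs : ∀ s : ℝ, HasDerivAt (fun s : ℝ => μ * (s : ℂ)) μ s := fun s => by
    simpa using (hasDerivAt_id s).ofReal_comp.const_mul μ
  have hexp : ∀ t : ℝ, HasDerivAt (fun t : ℝ => cexp (-(q * t))) (cexp (-(q * t)) * (-q)) t := by
    intro t
    have h1 : HasDerivAt (fun t : ℝ => -(q * (t : ℂ))) (-q) t := by
      simpa using ((hasDerivAt_id t).ofReal_comp.const_mul q).fun_neg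
    exact h1.cexp
  -- Four integrations by parts at once: as `μ = w q`, the derivative of `H(μs) e^{-qs}` is `q (w H'
  -- - H) e^{-qs}`, and `w H' - H` telescopes to `w⁴ kernel₄ - kernel`.
  set H : ℂ → ℂ := fun u => kernel u + w * kernel₁ u + w ^ 2 * kernel₂ u + w ^ 3 * kernel₃ u with hH
  have hHd : ∀ u ∈ kernelDomain, HasDerivAt H
      (kernel₁ u + w * kernel₂ u + w ^ 2 * kernel₃ u + w ^ 3 * kernel₄ u) u := fun u hu =>
    (((hasDerivAt_kernel hu).fun_add ((hasDerivAt_kernel₁ hu).const_mul w)).fun_add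
      ((hasDerivAt_kernel₂ hu).const_mul (w ^ 2))).fun_add ((hasDerivAt_kernel₃ hu).const_mul (w ^ 3))
  have hH0 : H 0 = 0 := by simp [hH, kernel_zero, kernel₁_zero, kernel₂_zero, kernel₃_zero]
  have hHb : ∀ u : ℂ, 2 ≤ ‖u‖ →
      ‖H u‖ ≤ (30 * (1 + ‖w‖ + ‖w‖ ^ 2 + ‖w‖ ^ 3)) * ‖u‖ ^ 3 := by
    intro u hu
    calc ‖H u‖ ≤ ‖kernel u‖ + ‖w‖ * ‖kernel₁ u‖ + ‖w‖ ^ 2 * ‖kernel₂ u‖ + ‖w‖ ^ 3 * ‖kernel₃ u‖ := by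
          refine (norm_add_le _ _).trans (add_le_add ((norm_add_le _ _).trans
            (add_le_add ((norm_add_le _ _).trans (add_le_add le_rfl ?_)) ?_)) ?_) <;>
          simp
      _ ≤ 30 * ‖u‖ ^ 3 + ‖w‖ * (30 * ‖u‖ ^ 3) + ‖w‖ ^ 2 * (30 * ‖u‖ ^ 3)
          + ‖w‖ ^ 3 * (30 * ‖u‖ ^ 3) := by
          gcongr
          · exact norm_kernel_le_of_two_le hu
          · exact norm_kernel₁_le_of_two_le hu
          · exact norm_kernel₂_le_of_two_le hu
          · exact norm_kernel₃_le_of_two_le hu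
      _ = _ := by ring
  have hftc := integral_Ioi_of_hasDerivAt_of_tendsto (a := 0) (m := 0)
    (f := fun s : ℝ => H (μ * s) * cexp (-(q * s)))
    (f' := fun s : ℝ => q * w ^ 4 * (kernel₄ (μ * s) * cexp (-(q * s)))
      - q * (kernel (μ * s) * cexp (-(q * s)))) ?_ ?_ ?_ ?_
  · rw [integral_sub (hi4.const_mul _) (hi1.const_mul _), integral_const_mul,
      integral_const_mul] at hftc
    simp only [ofReal_zero, mul_zero, hH0, zero_mul, sub_zero, sub_eq_zero] at hftc
    rw [mul_assoc] at hftc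
    exact (mul_left_cancel₀ hq0 hftc).symm
  · have h1 : ContinuousAt H (μ * ((0 : ℝ) : ℂ)) := by
      rw [ofReal_zero, mul_zero]
      exact (hHd 0 zero_mem_kernelDomain).continuousAt
    exact ((ContinuousAt.comp (f := fun s : ℝ => μ * (s : ℂ)) h1 (by fun_prop)).mul
      (by fun_prop)).continuousWithinAt
  · intro s hs
    have h1 := HasDerivAt.comp (h := fun s : ℝ => μ * (s : ℂ)) s
      (hHd _ (mul_ofReal_mem_kernelDomain hwq hs)) (hμs s)
    refine (h1.fun_mul (hexp s)).congr_deriv ?_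
    simp only [hH, Function.comp]
    rw [hμ]
    ring
  · exact (hi4.const_mul _).sub (hi1.const_mul _)
  · have hlim := ((tendsto_pow_mul_exp_neg_mul 3 hq).const_mul
      ((30 * (1 + ‖w‖ + ‖w‖ ^ 2 + ‖w‖ ^ 3)) * ‖μ‖ ^ 3))
    rw [mul_zero] at hlim
    refine squeeze_zero_norm' ?_ hlim
    filter_upwards [eventually_ge_atTop (2 / ‖μ‖), eventually_gt_atTop 0] with s hs hs0
    have hnorm : ‖μ * (s : ℂ)‖ = ‖μ‖ * s := by
      rw [norm_mul, norm_real, Real.norm_of_nonneg hs0.le]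
    rw [norm_mul, norm_cexp_neg_mul]
    have h1 := hHb (μ * s) (by rw [hnorm]; rwa [div_le_iff₀' hμ0] at hs)
    rw [hnorm, mul_pow] at h1
    calc _ ≤ (30 * (1 + ‖w‖ + ‖w‖ ^ 2 + ‖w‖ ^ 3)) * (‖μ‖ ^ 3 * s ^ 3) * Real.exp (-(q.re * s)) := by
          gcongr
      _ = _ := by ring

/-- The Laplace transform of the kernel as an absolutely convergent oscillating integral. -/
theorem integral_kernel_mul_exp {w : ℂ} (hw : 0 < w.re) :
    ∫ s in Set.Ioi (0 : ℝ), kernel s * cexp (-(w⁻¹ * s))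
      = I * w ^ 5 * ∫ s in Set.Ioi (0 : ℝ), kernel₄ (I * w * s) * cexp (-(I * s)) := by
  have hw0 : w ≠ 0 := by rintro rfl; simp at hw
  have hn : 0 < ‖w‖ := norm_pos_iff.2 hw0
  have hp : 0 < (w⁻¹).re := by
    rw [inv_re]; exact div_pos hw (normSq_pos.2 hw0)
  -- The direction `I w` would give `|e^{-is}| = 1`, so the ray is taken along `w (I + δ)`, for
  -- which the exponent is `-(I + δ) s`, and `δ → 0+` afterwards.
  have ha : Tendsto (fun δ : ℝ => w * (1 - δ * I)) (𝓝[>] 0) (𝓝 w) := by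
    have : Continuous fun δ : ℝ => w * (1 - δ * I) := by fun_prop
    simpa using (this.tendsto 0).mono_left nhdsWithin_le_nhds
  have hq : Tendsto (fun δ : ℝ => (I + δ : ℂ)) (𝓝[>] 0) (𝓝 I) := by
    have : Continuous fun δ : ℝ => (I + δ : ℂ) := by fun_prop
    simpa using (this.tendsto 0).mono_left nhdsWithin_le_nhds
  have hev : ∀ᶠ δ : ℝ in 𝓝[>] 0, w.re / 2 < (w * (1 - δ * I)).re ∧
      ‖w * (1 - δ * I)‖ < 2 * ‖w‖ := by
    have h1 := (continuous_re.tendsto w).comp ha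
    exact (h1.eventually (lt_mem_nhds (by linarith))).and
      (ha.norm.eventually (gt_mem_nhds (by linarith)))
  have heq : ∀ δ : ℝ, w * (I + δ) = I * (w * (1 - δ * I)) := by
    intro δ
    linear_combination (w * δ) * I_sq
  have hlim : Tendsto (fun δ : ℝ => (I + δ) * w ^ 5 * ∫ s in Set.Ioi (0 : ℝ),
      kernel₄ (I * (w * (1 - δ * I)) * s) * cexp (-((I + δ) * s))) (𝓝[>] 0)
      (𝓝 (I * w ^ 5 * ∫ s in Set.Ioi (0 : ℝ), kernel₄ (I * w * s) * cexp (-(I * s)))) := by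
    refine (hq.mul_const _).mul (tendsto_integral_filter_of_dominated_convergence
      (fun s => (2 * (2 * ‖w‖) ^ 2 / (w.re / 2) ^ 2) ^ 2 * (1 + (w.re / 2 * s) ^ 2)⁻¹) ?_ ?_ ?_ ?_)
    · filter_upwards [hev] with δ hδ
      exact ((continuous_kernel₄_ray (by linarith)).mul (by fun_prop)).aestronglyMeasurable
    · filter_upwards [hev, self_mem_nhdsWithin] with δ hδ hδ0
      filter_upwards [ae_restrict_mem measurableSet_Ioi] with s hs
      have hs0 : (0 : ℝ) < s := hs
      have hδ0' : (0 : ℝ) < δ := hδ0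
      have h1 := norm_kernel₄_le (a := w * (1 - δ * I)) (by linarith) s
      have h2 : w.re / 2 ≤ ‖w * (1 - δ * I)‖ := hδ.1.le.trans (re_le_norm _)
      rw [norm_mul, norm_cexp_neg_mul]
      refine (mul_le_of_le_one_right (norm_nonneg _) ?_).trans (h1.trans ?_)
      · rw [Real.exp_le_one_iff]
        simp; positivity
      · obtain ⟨h3, h4⟩ := hδ
        gcongr
    · exact ((integrable_inv_one_add_mul_sq (by positivity)).const_mul _).integrableOn
    · filter_upwards with s
      refine Tendsto.mul ?_ ?_
      · have h1 : ContinuousAt (fun a : ℂ => (1 - a ^ 2 * (s : ℂ) ^ 2) /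
            (1 + a ^ 2 * (s : ℂ) ^ 2) ^ 2) w := by
          refine ContinuousAt.div (by fun_prop) (by fun_prop)
            (pow_ne_zero 2 (one_add_sq_mul_sq_ne_zero hw s))
        simp only [kernel₄_I_mul]
        exact h1.tendsto.comp ha
      · have : Continuous fun z : ℂ => cexp (-(z * s)) := by fun_prop
        exact (this.tendsto I).comp hq
  refine tendsto_nhds_unique (tendsto_const_nhds (f := 𝓝[>] (0 : ℝ))) (hlim.congr' ?_)
  filter_upwards [hev, self_mem_nhdsWithin] with δ hδ hδ0
  have hδ0' : (0 : ℝ) < δ := hδ0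
  have him : 0 < (w * (I + δ)).im := by
    rw [heq, I_mul_im]; linarith
  have hpd : w⁻¹ * (w * (I + δ)) = I + δ := by field_simp
  have hray := rayLaplace_eq (p := w⁻¹) (d := w * (I + δ)) hp ⟨him, by rw [hpd]; simpa using hδ0'⟩
  rw [← hray, rayLaplace, hpd, integral_kernel_eq_integral_kernel₄ (by simpa using hδ0') him, heq]
  linear_combination ((w ^ 4 * ∫ s in Set.Ioi (0 : ℝ),
      kernel₄ (I * (w * (1 - δ * I)) * s) * cexp (-((I + δ) * s)))) * heq δ

/-! ### The oscillating integrals -/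

theorem hasDerivAt_div_one_add {w : ℂ} (hw : 0 < w.re) (s : ℝ) :
    HasDerivAt (fun s : ℝ => (s : ℂ) / (1 + w ^ 2 * (s : ℂ) ^ 2)) (kernel₄ (I * w * s)) s := by
  have h0 := one_add_sq_mul_sq_ne_zero hw s
  have h1 : HasDerivAt (fun s : ℝ => (s : ℂ)) 1 s := by simpa using (hasDerivAt_id s).ofReal_comp
  have h2 : HasDerivAt (fun s : ℝ => 1 + w ^ 2 * (s : ℂ) ^ 2) (w ^ 2 * (2 * s)) s := by
    simpa using ((h1.fun_pow 2).const_mul (w ^ 2)).const_add 1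
  refine (h1.fun_div h2 h0).congr_deriv ?_
  rw [kernel₄_I_mul]
  congr 1
  ring

/-- One integration by parts, `kernel₄ (I w s)` being the derivative of `s/(1 + w²s²)`. The
conditionally convergent integral becomes an absolutely convergent one. -/
theorem integral_osc_eq {w : ℂ} (hw : 0 < w.re) (T : ℝ) :
    ∫ s in (0 : ℝ)..T, cexp (-(I * s)) * ((s : ℂ) / (1 + w ^ 2 * (s : ℂ) ^ 2))
      = I * cexp (-(I * T)) * ((T : ℂ) / (1 + w ^ 2 * (T : ℂ) ^ 2))
        - I * ∫ s in (0 : ℝ)..T, kernel₄ (I * w * s) * cexp (-(I * s)) := by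
  have hexp : ∀ t : ℝ, HasDerivAt (fun t : ℝ => cexp (-(I * t))) (cexp (-(I * t)) * (-I)) t := by
    intro t
    have h1 : HasDerivAt (fun t : ℝ => -(I * (t : ℂ))) (-I) t := by
      simpa using ((hasDerivAt_id t).ofReal_comp.const_mul I).fun_neg
    exact h1.cexp
  have hc1 : Continuous fun s : ℝ => cexp (-(I * s)) * ((s : ℂ) / (1 + w ^ 2 * (s : ℂ) ^ 2)) :=
    Continuous.mul (by fun_prop) (Continuous.div (by fun_prop) (by fun_prop)
      (one_add_sq_mul_sq_ne_zero hw))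
  have hc2 : Continuous fun s : ℝ => kernel₄ (I * w * s) * cexp (-(I * s)) :=
    (continuous_kernel₄_ray hw).mul (by fun_prop)
  have h := intervalIntegral.integral_eq_sub_of_hasDerivAt (a := 0) (b := T)
    (f := fun s : ℝ => I * cexp (-(I * s)) * ((s : ℂ) / (1 + w ^ 2 * (s : ℂ) ^ 2)))
    (f' := fun s : ℝ => cexp (-(I * s)) * ((s : ℂ) / (1 + w ^ 2 * (s : ℂ) ^ 2))
      + I * (kernel₄ (I * w * s) * cexp (-(I * s)))) (fun s _ => by
        refine (((hexp s).const_mul I).fun_mul (hasDerivAt_div_one_add hw s)).congr_deriv ?_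
        linear_combination (-(cexp (-(I * s)) * ((s : ℂ) / (1 + w ^ 2 * (s : ℂ) ^ 2)))) * I_sq)
    ((hc1.add (continuous_const.mul hc2)).intervalIntegrable _ _)
  rw [intervalIntegral.integral_add (hc1.intervalIntegrable _ _)
    ((hc2.intervalIntegrable _ _).const_mul I), intervalIntegral.integral_const_mul] at h
  simp only [ofReal_zero, zero_div, mul_zero, sub_zero] at h
  rw [← h]; ring

theorem norm_div_one_add_le {w : ℂ} (hw : 0 < w.re) {s : ℝ} (hs : 0 ≤ s) :
    ‖(s : ℂ) / (1 + w ^ 2 * (s : ℂ) ^ 2)‖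
      ≤ 2 * ‖w‖ ^ 2 / w.re ^ 2 * (s / (1 + (‖w‖ * s) ^ 2)) := by
  have hn : 0 < ‖w‖ := norm_pos_iff.2 (by rintro rfl; simp at hw)
  have h1 := norm_one_add_sq_mul_sq_ge hw s
  have h3 : 0 < w.re ^ 2 / (2 * ‖w‖ ^ 2) * (1 + ‖w‖ ^ 2 * s ^ 2) := by positivity
  rw [norm_div, norm_real, Real.norm_of_nonneg hs]
  calc _ ≤ s / (w.re ^ 2 / (2 * ‖w‖ ^ 2) * (1 + ‖w‖ ^ 2 * s ^ 2)) := by gcongr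
    _ = _ := by
      rw [mul_pow ‖w‖ s]
      have : 1 + ‖w‖ ^ 2 * s ^ 2 ≠ 0 := by positivity
      field_simp

theorem tendsto_integral_osc {w : ℂ} (hw : 0 < w.re) :
    Tendsto (fun T : ℝ => ∫ s in (0 : ℝ)..T,
      cexp (-(I * s)) * ((s : ℂ) / (1 + w ^ 2 * (s : ℂ) ^ 2))) atTop
      (𝓝 (-I * ∫ s in Set.Ioi (0 : ℝ), kernel₄ (I * w * s) * cexp (-(I * s)))) := by
  have hn : 0 < ‖w‖ := norm_pos_iff.2 (by rintro rfl; simp at hw)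
  simp only [integral_osc_eq hw]
  have h1 := (intervalIntegral_tendsto_integral_Ioi 0
    (integrable_kernel₄_ray_mul hw (q := I) (by simp)) tendsto_id).const_mul I
  have h2 : Tendsto (fun T : ℝ => I * cexp (-(I * T)) * ((T : ℂ) / (1 + w ^ 2 * (T : ℂ) ^ 2)))
      atTop (𝓝 0) := by
    have h3 : Tendsto (fun T : ℝ => 2 * ‖w‖ ^ 2 / w.re ^ 2 * (‖w‖ ^ 2)⁻¹ * T⁻¹) atTop (𝓝 0) := by
      have := (tendsto_inv_atTop_zero (𝕜 := ℝ)).const_mul (2 * ‖w‖ ^ 2 / w.re ^ 2 * (‖w‖ ^ 2)⁻¹)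
      rwa [mul_zero] at this
    refine squeeze_zero_norm' ?_ h3
    filter_upwards [eventually_gt_atTop 0] with T hT
    rw [norm_mul, norm_mul, norm_I, norm_cexp_neg_mul]
    simp only [I_re, zero_mul, neg_zero, Real.exp_zero, one_mul]
    refine (norm_div_one_add_le hw hT.le).trans ?_
    rw [mul_assoc]
    gcongr
    rw [← mul_inv, div_le_iff₀ (by positivity)]
    have : (‖w‖ ^ 2 * T)⁻¹ * (1 + (‖w‖ * T) ^ 2) = T + (‖w‖ ^ 2 * T)⁻¹ := by
      field_simp; ring
    rw [this]
    have : 0 < (‖w‖ ^ 2 * T)⁻¹ := by positivity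
    linarith
  simpa using h2.sub h1

/-- Uniform in `T` and of order `1/‖w‖` at fixed aperture. Against the weight `w⁴` this leaves
`p_k⁻³`, which is summable. -/
theorem norm_integral_osc_le {w : ℂ} (hw : 0 < w.re) {T : ℝ} (hT : 0 ≤ T) :
    ‖∫ s in (0 : ℝ)..T, cexp (-(I * s)) * ((s : ℂ) / (1 + w ^ 2 * (s : ℂ) ^ 2))‖
      ≤ (2 * ‖w‖ ^ 2 / w.re ^ 2 + 2 * (2 * ‖w‖ ^ 2 / w.re ^ 2) ^ 2) / ‖w‖ := by
  have hn : 0 < ‖w‖ := norm_pos_iff.2 (by rintro rfl; simp at hw)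
  rw [integral_osc_eq hw]
  refine (norm_sub_le _ _).trans ?_
  rw [add_div]
  refine add_le_add ?_ ?_
  · rw [norm_mul, norm_mul, norm_I, norm_cexp_neg_mul]
    simp only [I_re, zero_mul, neg_zero, Real.exp_zero, one_mul]
    refine (norm_div_one_add_le hw hT).trans ?_
    rw [div_eq_mul_inv _ ‖w‖]
    gcongr
    rw [div_le_iff₀ (by positivity), inv_mul_eq_div, le_div_iff₀ hn]
    -- `x/(1 + x²) ≤ 1` with `x = ‖w‖ T`.
    nlinarith [sq_nonneg (‖w‖ * T - 1)]
  · rw [norm_mul, norm_I, one_mul]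
    have hint := (integrable_inv_one_add_mul_sq hn.ne').const_mul ((2 * ‖w‖ ^ 2 / w.re ^ 2) ^ 2)
    calc _ ≤ ∫ s in (0 : ℝ)..T, (2 * ‖w‖ ^ 2 / w.re ^ 2) ^ 2 * (1 + (‖w‖ * s) ^ 2)⁻¹ := by
          refine intervalIntegral.norm_integral_le_of_norm_le hT ?_ hint.intervalIntegrable
          filter_upwards with s _
          rw [norm_mul, norm_cexp_neg_mul]
          simpa using norm_kernel₄_le hw s
      _ ≤ ∫ s in Set.Ioi (0 : ℝ), (2 * ‖w‖ ^ 2 / w.re ^ 2) ^ 2 * (1 + (‖w‖ * s) ^ 2)⁻¹ := by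
          rw [intervalIntegral.integral_of_le hT]
          refine setIntegral_mono_set hint.integrableOn ?_ ?_
          · filter_upwards with s
            positivity
          · exact Set.Ioc_subset_Ioi_self.eventuallyLE
      _ = (2 * ‖w‖ ^ 2 / w.re ^ 2) ^ 2 * (‖w‖⁻¹ * (Real.pi / 2)) := by
          rw [integral_const_mul,
            integral_comp_mul_left_Ioi (fun s : ℝ => (1 + s ^ 2)⁻¹) 0 hn, mul_zero,
            integral_Ioi_inv_one_add_sq]
          simp
      _ ≤ _ := by
          have h2 : Real.pi / 2 ≤ 2 := by linarith [Real.pi_lt_four]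
          calc _ ≤ (2 * ‖w‖ ^ 2 / w.re ^ 2) ^ 2 * (‖w‖⁻¹ * 2) := by gcongr
            _ = _ := by ring

/-! ### The singularities of the Borel transform and the coefficients -/

/-- The singularities `(k + 1) √π / 2` of the Borel transform. -/
def pole (k : ℕ) : ℝ := (k + 1) * (√Real.pi / 2)

theorem pole_pos (k : ℕ) : 0 < pole k := by
  have := Real.pi_pos
  unfold pole; positivity

theorem pole_sq (k : ℕ) : pole k ^ 2 = (k + 1) ^ 2 * (Real.pi / 4) := by
  rw [pole, mul_pow, div_pow, Real.sq_sqrt Real.pi_pos.le]; norm_num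

theorem pole_zero_le (k : ℕ) : pole 0 ≤ pole k := by
  have := Real.pi_pos
  unfold pole; gcongr; simp

theorem pole_eq (k : ℕ) : pole k = (k + 1) * pole 0 := by simp [pole]

theorem summable_inv_succ_pow {m : ℕ} (hm : 2 ≤ m) :
    Summable fun k : ℕ => (((k : ℝ) + 1) ^ m)⁻¹ := by
  have h := (summable_nat_add_iff 1).2 (Real.summable_nat_pow_inv (p := m).2 (by omega))
  simpa using h

theorem summable_inv_pole_pow {m : ℕ} (hm : 2 ≤ m) : Summable fun k => ((pole k)⁻¹) ^ m := by
  refine ((summable_inv_succ_pow hm).mul_left ((pole 0)⁻¹ ^ m)).congr fun k => ?_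
  rw [pole_eq k, mul_inv, mul_pow, inv_pow ((k : ℝ) + 1), mul_comm]

/-- The sums of the inverse powers of the singularities. -/
def poleSum (m : ℕ) : ℝ := ∑' k, ((pole k)⁻¹) ^ m

theorem poleSum_pos {m : ℕ} (hm : 2 ≤ m) : 0 < poleSum m :=
  (summable_inv_pole_pow hm).tsum_pos (fun k => by have := pole_pos k; positivity) 0
    (by have := pole_pos 0; positivity)

theorem inv_pole_pow_two_mul (n k : ℕ) :
    ((pole k)⁻¹) ^ (2 * n) = (4 / Real.pi) ^ n * (((k : ℝ) + 1) ^ (2 * n))⁻¹ := by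
  rw [inv_pow, pow_mul, pole_sq, mul_pow, mul_inv, ← pow_mul, mul_comm, ← inv_pow, inv_div]

theorem poleSum_two_mul (n : ℕ) :
    poleSum (2 * n) = (4 / Real.pi) ^ n * ∑' k : ℕ, (((k : ℝ) + 1) ^ (2 * n))⁻¹ := by
  rw [poleSum, ← tsum_mul_left]
  exact tsum_congr fun k => inv_pole_pow_two_mul n k

theorem hasSum_zeta_succ {n : ℕ} (hn : n ≠ 0) :
    HasSum (fun k : ℕ => (((k : ℝ) + 1) ^ (2 * n))⁻¹)
      ((-1 : ℝ) ^ (n + 1) * (2 : ℝ) ^ (2 * n - 1) * Real.pi ^ (2 * n) *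
        bernoulli (2 * n) / (2 * n).factorial) := by
  have h := (hasSum_nat_add_iff' 1).2 (hasSum_zeta_nat hn)
  simpa [hn] using h

theorem kernelCoeff_two_mul {n : ℕ} (hn : 2 ≤ n) :
    kernelCoeff (2 * n) = ((2 * n - 3).factorial : ℝ) / (2 * n).factorial := by
  obtain ⟨m, rfl⟩ := Nat.exists_eq_add_of_le hn
  have h1 : 2 * (2 + m) = 2 * m + 1 + 1 + 1 + 1 := by ring
  have h2 : 2 * (2 + m) - 3 = 2 * m + 1 := by omega
  have h3 : ((2 * m + 1).factorial : ℝ) ≠ 0 := by positivity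
  rw [kernelCoeff, if_pos (even_two_mul _), h2, h1]
  rw [Nat.factorial_succ (2 * m + 1 + 1 + 1), Nat.factorial_succ (2 * m + 1 + 1),
    Nat.factorial_succ (2 * m + 1)]
  push_cast
  have e1 : (2 * (m : ℝ) + 1 + 1 + 1 + 1 - 1) = 2 * m + 1 + 1 + 1 := by ring
  have e2 : (2 * (m : ℝ) + 1 + 1 + 1 + 1 - 2) = 2 * m + 1 + 1 := by ring
  rw [e1, e2]
  field_simp

/-- Euler's formula for `ζ(2n)` absorbs the alternating sign of the Bernoulli numbers, leaving only
positive factors. -/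
theorem a_eq {n : ℕ} (hn : 2 ≤ n) :
    a n = 1 / (4 * Real.pi ^ 2) * (2 * n).factorial * kernelCoeff (2 * n) * poleSum (2 * n) := by
  rw [poleSum_two_mul, (hasSum_zeta_succ (by omega : n ≠ 0)).tsum_eq, kernelCoeff_two_mul hn, a,
    if_neg (by omega)]
  have hpi : Real.pi ≠ 0 := Real.pi_ne_zero
  have h3 : ((2 * n).factorial : ℝ) ≠ 0 := by positivity
  have e1 : (2 : ℝ) ^ (2 * n - 1) = 4 ^ n / 2 := by
    rw [eq_div_iff two_ne_zero, ← pow_succ, show 2 * n - 1 + 1 = 2 * n by omega, pow_mul]; norm_num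
  have e2 : (16 * Real.pi) ^ n = 4 ^ n * 4 ^ n * Real.pi ^ n := by
    rw [← mul_pow, ← mul_pow]; norm_num
  rw [e1, e2, div_pow, pow_succ, pow_mul, pow_two Real.pi, mul_pow]
  field_simp
  ring

theorem a_pos {n : ℕ} (hn : 2 ≤ n) : 0 < a n := by
  have hpi := Real.pi_pos
  have h1 := poleSum_pos (m := 2 * n) (by omega)
  have h2 : 0 < kernelCoeff (2 * n) := by rw [kernelCoeff_two_mul hn]; positivity
  rw [a_eq hn]; positivity

theorem sqrtSeries_coeff_div (j : ℕ) :
    sqrtSeries coeff j / (j.factorial : ℂ)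
      = -(1 / (4 * (Real.pi : ℂ) ^ 2)) * (kernelCoeff j * poleSum j) := by
  have hj : (j.factorial : ℂ) ≠ 0 := by exact_mod_cast j.factorial_ne_zero
  rcases Nat.even_or_odd j with he | ho
  · obtain ⟨n, rfl⟩ := he.two_dvd
    rw [sqrtSeries, if_pos he, Nat.mul_div_cancel_left n two_pos, coeff]
    rcases lt_or_ge n 2 with h | h
    · rw [a, if_pos h, kernelCoeff_eq_zero (by omega)]; simp
    · rw [a_eq h]
      push_cast
      field_simp
  · rw [sqrtSeries, if_neg (Nat.not_even_iff_odd.2 ho), kernelCoeff,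
      if_neg (Nat.not_even_iff_odd.2 ho)]
    simp

/-- This is `ζ(2n) → 1`: only the nearest pole survives, which fixes the constant in the growth of
`a_n`. -/
theorem tendsto_tsum_inv_succ_pow :
    Tendsto (fun n : ℕ => ∑' k : ℕ, (((k : ℝ) + 1) ^ (2 * n))⁻¹) atTop (𝓝 1) := by
  have h := tendsto_tsum_of_dominated_convergence (𝓕 := atTop)
    (f := fun (n k : ℕ) => (((k : ℝ) + 1) ^ (2 * n))⁻¹) (g := fun k : ℕ => if k = 0 then (1 : ℝ) else 0)
    (bound := fun k : ℕ => (((k : ℝ) + 1) ^ 2)⁻¹) (summable_inv_succ_pow le_rfl) ?_ ?_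
  · simpa using h
  · intro k
    rcases eq_or_ne k 0 with rfl | hk
    · simp
    · rw [if_neg hk]
      have h1 : 1 < ((k : ℝ) + 1) ^ 2 := by
        have : (1 : ℝ) ≤ k := by exact_mod_cast Nat.one_le_iff_ne_zero.2 hk
        nlinarith
      simp only [pow_mul]
      exact tendsto_inv_atTop_zero.comp (tendsto_pow_atTop_atTop_of_one_lt h1)
  · filter_upwards [eventually_ge_atTop 1] with n hn k
    rw [norm_inv, norm_pow, Real.norm_of_nonneg (by positivity)]
    gcongr
    · linarith [k.cast_nonneg (α := ℝ)]
    · omega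

theorem a_isEquivalent : a ~[atTop] (fun n : ℕ =>
    (4 / Real.pi) ^ n * ((2 * n).factorial : ℝ) / (32 * Real.pi ^ 2 * (n : ℝ) ^ 3)) := by
  have hpi := Real.pi_pos
  rw [isEquivalent_iff_tendsto_one]
  · have h1 : Tendsto (fun n : ℕ => (n : ℝ)⁻¹) atTop (𝓝 0) := tendsto_inv_atTop_nhds_zero_nat
    -- For `n ≥ 2` this product is exactly the ratio of `a n` to the claimed equivalent.
    have h2 : Tendsto (fun n : ℕ => (1 - (n : ℝ)⁻¹ / 2)⁻¹ * (1 - (n : ℝ)⁻¹)⁻¹ *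
        ∑' k : ℕ, (((k : ℝ) + 1) ^ (2 * n))⁻¹) atTop (𝓝 ((1 - 0 / 2)⁻¹ * (1 - 0)⁻¹ * 1)) :=
      ((((h1.div_const 2).const_sub 1).inv₀ (by norm_num)).mul
        ((h1.const_sub 1).inv₀ (by norm_num))).mul tendsto_tsum_inv_succ_pow
    norm_num at h2
    refine h2.congr' ?_
    filter_upwards [eventually_ge_atTop 2] with n hn
    have hn' : (2 : ℝ) ≤ n := by exact_mod_cast hn
    have h3 : ((2 * n).factorial : ℝ) ≠ 0 := by positivity
    rw [Pi.div_apply, a_eq hn, poleSum_two_mul, kernelCoeff, if_pos (even_two_mul n)]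
    push_cast
    have e1 : (2 * (n : ℝ) - 1) ≠ 0 := by linarith
    have e2 : (n : ℝ) - 1 ≠ 0 := by linarith
    have e3 : (2 * (n : ℝ) - 2) ≠ 0 := by linarith
    have e4 : (n : ℝ) ≠ 0 := by linarith
    have e5 : (1 - (n : ℝ)⁻¹ / 2) = (2 * n - 1) / (2 * n) := by field_simp
    have e6 : (1 - (n : ℝ)⁻¹) = (2 * n - 2) / (2 * n) := by field_simp
    norm_num
    rw [e5, e6]
    have h4 : (4 / Real.pi) ^ n ≠ 0 := by positivity
    field_simp
    ring
  · filter_upwards [eventually_ge_atTop 2] with n hn h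
    exfalso
    have : (0 : ℝ) < n := by exact_mod_cast (by omega : 0 < n)
    have h3 : 0 < (4 / Real.pi) ^ n * ((2 * n).factorial : ℝ) / (32 * Real.pi ^ 2 * (n : ℝ) ^ 3) := by
      positivity
    exact h3.ne' h

/-! ### The Borel transform -/

/-- The Borel transform of the perturbation series, continued to the upper half-plane and, by
continuity, to the positive real axis. -/
def borel (t : ℂ) : ℂ := -(1 / (4 * (Real.pi : ℂ) ^ 2)) * ∑' k, kernel (t / pole k)

/-- The union of the upper half-plane and the disk of convergence of the Borel transform. -/
def borelDomain : Set ℂ := Metric.ball 0 (pole 0) ∪ {t | 0 < t.im}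

theorem div_pole_mem_kernelDomain {t : ℂ} (ht : t ∈ borelDomain) (k : ℕ) :
    t / pole k ∈ kernelDomain := by
  have hk := pole_pos k
  rcases ht with ht | ht
  · right
    rw [mem_ball_zero_iff] at ht ⊢
    rw [norm_div, norm_real, Real.norm_of_nonneg hk.le, div_lt_one hk]
    exact ht.trans_le (pole_zero_le k)
  · left
    have ht' : 0 < t.im := ht
    simp only [Set.mem_ofPred_eq, div_ofReal_im]
    positivity

theorem norm_kernel_div_pole_le {C : ℝ} (hC : ∀ u : ℂ, ‖kernel u‖ ≤ C * ‖u‖ ^ 4) (t : ℂ) (k : ℕ) :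
    ‖kernel (t / pole k)‖ ≤ C * ‖t‖ ^ 4 * (pole k)⁻¹ ^ 4 := by
  have h := hC (t / pole k)
  rwa [norm_div, norm_real, Real.norm_of_nonneg (pole_pos k).le, div_eq_mul_inv ‖t‖, mul_pow,
    ← mul_assoc] at h

theorem summable_kernel_div_pole (t : ℂ) : Summable fun k => kernel (t / pole k) := by
  obtain ⟨C, _, hC⟩ := exists_norm_kernel_le
  exact Summable.of_norm_bounded ((summable_inv_pole_pow (m := 4) (by norm_num)).mul_left _)
    (norm_kernel_div_pole_le hC t)

theorem summable_kernelCoeff_mul_poleSum (j : ℕ) :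
    HasSum (fun k => (kernelCoeff j : ℂ) * ((pole k : ℂ)⁻¹) ^ j) (kernelCoeff j * poleSum j) := by
  rcases lt_or_ge j 4 with h | h
  · rw [kernelCoeff_eq_zero h]
    simp
  · have := (summable_inv_pole_pow (m := j) (by omega)).hasSum
    exact_mod_cast (Complex.hasSum_ofReal.2 this).mul_left (kernelCoeff j : ℂ)

/-- Interchange of a double series: summing over `j` first gives `kernel (t / p_k)`, summing over
`k` first gives the power sums of the poles. -/
theorem hasSum_borel {t : ℂ} (ht : ‖t‖ < pole 0) :
    HasSum (fun j : ℕ => sqrtSeries coeff j / (j.factorial : ℂ) * t ^ j) (borel t) := by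
  have h0 := pole_pos 0
  set r := ‖t‖ / pole 0 with hr
  have hr1 : r < 1 := (div_lt_one h0).2 ht
  have hr0 : 0 ≤ r := by positivity
  set f : ℕ × ℕ → ℂ := fun x => (kernelCoeff x.2 : ℂ) * (t / pole x.1) ^ x.2 with hf
  have hsum : Summable f := by
    -- The norm of `t / p_k` is `r/(k+1)`, and only `j ≥ 4` contributes, so `(k+1)⁻⁴ r^j` dominates.
    have hb : Summable fun x : ℕ × ℕ => (((x.1 : ℝ) + 1) ^ 4)⁻¹ * r ^ x.2 :=
      (summable_inv_succ_pow (m := 4) (by norm_num)).mul_of_nonneg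
        (summable_geometric_of_lt_one hr0 hr1) (fun k => by simp only [Pi.zero_apply]; positivity)
        (fun j => by simp only [Pi.zero_apply]; positivity)
    refine Summable.of_norm_bounded hb fun x => ?_
    obtain ⟨k, j⟩ := x
    rcases lt_or_ge j 4 with h | h
    · simp only [hf, kernelCoeff_eq_zero h]
      simp only [ofReal_zero, zero_mul, norm_zero]
      positivity
    · refine (norm_kernelCoeff_mul_pow_le _ _).trans ?_
      have hn : ‖t / (pole k : ℂ)‖ = ((k : ℝ) + 1)⁻¹ * r := by
        rw [norm_div, norm_real, Real.norm_of_nonneg (pole_pos k).le, pole_eq k, hr]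
        field_simp
      simp only [hn, mul_pow, inv_pow]
      refine mul_le_mul_of_nonneg_right ?_ (pow_nonneg hr0 j)
      exact inv_anti₀ (by positivity)
        (pow_le_pow_right₀ (by linarith [k.cast_nonneg (α := ℝ)]) h)
  have hrow : ∀ k, HasSum (fun j => f (k, j)) (kernel (t / pole k)) := fun k => by
    have hk : ‖t / (pole k : ℂ)‖ < 1 := by
      rw [norm_div, norm_real, Real.norm_of_nonneg (pole_pos k).le, div_lt_one (pole_pos k)]
      exact ht.trans_le (pole_zero_le k)
    exact HasSum.congr_of_eq (hasSum_kernel hk) (fun j => rfl) rfl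
  have hcol : ∀ j, HasSum (fun k => f (k, j)) (kernelCoeff j * poleSum j * t ^ j) := fun j => by
    refine HasSum.congr_of_eq ((summable_kernelCoeff_mul_poleSum j).mul_right (t ^ j))
      (fun k => ?_) rfl
    simp only [hf, div_eq_mul_inv, mul_pow]
    ring
  have h1 : HasSum (fun k => kernel (t / pole k)) (∑' x, f x) := hsum.hasSum.prod_fiberwise hrow
  have h2 : HasSum (fun j => kernelCoeff j * poleSum j * t ^ j) (∑' x, f x) := by
    have h3 := (Equiv.prodComm ℕ ℕ).hasSum_iff.2 hsum.hasSum
    exact h3.prod_fiberwise hcol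
  refine HasSum.congr_of_eq (h2.mul_left (-(1 / (4 * (Real.pi : ℂ) ^ 2)))) (fun j => ?_) ?_
  · rw [sqrtSeries_coeff_div]; ring
  · rw [borel, h1.tsum_eq]

theorem exists_norm_borel_sub_sum_le {M : ℕ} (hM : 4 ≤ M) : ∃ C : ℝ, 0 < C ∧ ∀ t : ℂ,
    ‖borel t - ∑ j ∈ Finset.range M, sqrtSeries coeff j / (j.factorial : ℂ) * t ^ j‖
      ≤ C * ‖t‖ ^ M := by
  refine ⟨‖-(1 / (4 * (Real.pi : ℂ) ^ 2))‖ * (((1000 + M) * 2 ^ M) * poleSum M), ?_, fun t => ?_⟩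
  · have h1 := poleSum_pos (m := M) (by omega)
    have h2 : 0 < ‖-(1 / (4 * (Real.pi : ℂ) ^ 2))‖ := by
      rw [norm_pos_iff]
      have : (Real.pi : ℂ) ≠ 0 := by exact_mod_cast Real.pi_ne_zero
      simp [this]
    positivity
  have h1 : ∑ j ∈ Finset.range M, sqrtSeries coeff j / (j.factorial : ℂ) * t ^ j
      = -(1 / (4 * (Real.pi : ℂ) ^ 2)) *
        ∑' k, ∑ j ∈ Finset.range M, (kernelCoeff j : ℂ) * (t / pole k) ^ j := by
    have h2 : HasSum (fun k => ∑ j ∈ Finset.range M, (kernelCoeff j : ℂ) * (t / pole k) ^ j)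
        (∑ j ∈ Finset.range M, kernelCoeff j * poleSum j * t ^ j) := by
      refine hasSum_sum fun j _ => ?_
      refine HasSum.congr_of_eq ((summable_kernelCoeff_mul_poleSum j).mul_right (t ^ j))
        (fun k => ?_) rfl
      simp only [div_eq_mul_inv, mul_pow]
      ring
    rw [h2.tsum_eq, Finset.mul_sum]
    refine Finset.sum_congr rfl fun j _ => ?_
    rw [sqrtSeries_coeff_div]; ring
  have h3 : Summable fun k => ∑ j ∈ Finset.range M, (kernelCoeff j : ℂ) * (t / pole k) ^ j := by
    refine summable_sum fun j _ => ?_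
    refine ((summable_kernelCoeff_mul_poleSum j).summable.mul_right (t ^ j)).congr fun k => ?_
    simp only [div_eq_mul_inv, mul_pow]
    ring
  rw [h1, borel, ← mul_sub, ← (summable_kernel_div_pole t).tsum_sub h3, norm_mul, mul_assoc]
  gcongr
  have h4 := (summable_inv_pole_pow (m := M) (by omega)).hasSum.mul_left
    (((1000 + M) * 2 ^ M) * ‖t‖ ^ M)
  refine (tsum_of_norm_bounded h4 fun k => ?_).trans_eq (by rw [poleSum]; ring)
  refine (norm_kernel_sub_sum_le hM _).trans_eq ?_
  rw [norm_div, norm_real, Real.norm_of_nonneg (pole_pos k).le, div_eq_mul_inv, mul_pow]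
  ring

theorem exists_norm_borel_le : ∃ C : ℝ, 0 < C ∧ ∀ t : ℂ, ‖borel t‖ ≤ C * ‖t‖ ^ 4 := by
  obtain ⟨C, hC0, hC⟩ := exists_norm_borel_sub_sum_le (M := 4) le_rfl
  refine ⟨C, hC0, fun t => ?_⟩
  have h := hC t
  rwa [Finset.sum_eq_zero, sub_zero] at h
  intro j hj
  rw [sqrtSeries_coeff_div, kernelCoeff_eq_zero (Finset.mem_range.1 hj)]; simp

theorem isOpen_borelDomain : IsOpen borelDomain :=
  Metric.isOpen_ball.union (isOpen_lt continuous_const continuous_im)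

theorem differentiableOn_borel : DifferentiableOn ℂ borel borelDomain := by
  obtain ⟨C, hC0, hC⟩ := exists_norm_kernel_le
  intro t ht
  have hopen : IsOpen (borelDomain ∩ Metric.ball 0 (‖t‖ + 1)) :=
    isOpen_borelDomain.inter Metric.isOpen_ball
  have h := differentiableOn_tsum_of_summable_norm (U := borelDomain ∩ Metric.ball 0 (‖t‖ + 1))
    (F := fun k t => kernel (t / pole k)) (u := fun k => C * (‖t‖ + 1) ^ 4 * (pole k)⁻¹ ^ 4)
    ((summable_inv_pole_pow (m := 4) (by norm_num)).mul_left _) ?_ hopen ?_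
  · have hmem : t ∈ borelDomain ∩ Metric.ball 0 (‖t‖ + 1) := ⟨ht, by simp⟩
    exact ((h.differentiableAt (hopen.mem_nhds hmem)).const_mul _).differentiableWithinAt
  · intro k z hz
    have h1 := (hasDerivAt_kernel (div_pole_mem_kernelDomain hz.1 k)).differentiableAt
    have h2 : DifferentiableAt ℂ (fun z : ℂ => z / (pole k : ℂ)) z := by fun_prop
    exact (DifferentiableAt.fun_comp' (f := fun z : ℂ => z / (pole k : ℂ)) z h1
      h2).differentiableWithinAt
  · intro k z hz
    refine (norm_kernel_div_pole_le hC z k).trans ?_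
    have h3 : ‖z‖ < ‖t‖ + 1 := by simpa using hz.2
    have := pole_pos k
    gcongr

/-- Each singularity on the positive axis is mild enough for continuity, and the quartic bound gives
locally uniform convergence of the sum. -/
theorem continuousOn_borel : ContinuousOn borel {t | 0 ≤ t.im ∧ 0 ≤ t.re} := by
  obtain ⟨C, hC0, hC⟩ := exists_norm_kernel_le
  intro t ht
  have h := continuousOn_tsum (s := {t | 0 ≤ t.im ∧ 0 ≤ t.re} ∩ Metric.ball 0 (‖t‖ + 1))
    (f := fun k t => kernel (t / pole k)) (u := fun k => C * (‖t‖ + 1) ^ 4 * (pole k)⁻¹ ^ 4)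
    ?_ ((summable_inv_pole_pow (m := 4) (by norm_num)).mul_left _) ?_
  · have hmem : t ∈ {t : ℂ | 0 ≤ t.im ∧ 0 ≤ t.re} ∩ Metric.ball 0 (‖t‖ + 1) := ⟨ht, by simp⟩
    exact (continuousWithinAt_inter (Metric.isOpen_ball.mem_nhds hmem.2)).1
      ((h t hmem).const_mul _)
  · intro k
    refine continuousOn_kernel.comp (by fun_prop) fun z hz => ?_
    have := pole_pos k
    obtain ⟨h1, h2⟩ := hz.1
    simp only [Set.mem_ofPred_eq, div_ofReal_im, div_ofReal_re]
    constructor <;> positivity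
  · intro k z hz
    refine (norm_kernel_div_pole_le hC z k).trans ?_
    have h3 : ‖z‖ < ‖t‖ + 1 := by simpa using hz.2
    have := pole_pos k
    gcongr

theorem continuousOn_borel_ofReal : ContinuousOn (fun t : ℝ => borel t) (Set.Ici 0) :=
  continuousOn_borel.comp (by fun_prop) fun s hs => by simpa using hs

/-! ### The Laplace-Borel integral -/

/-- The Laplace-Borel integral of the boundary value of the Borel transform. -/
def laplaceBorel (β : ℂ) : ℂ :=
  β⁻¹ * ∫ t in Set.Ioi (0 : ℝ), borel t * cexp (-(β⁻¹ * t))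

theorem inv_re_pos {β : ℂ} (hβ : 0 < β.re) : 0 < (β⁻¹).re := by
  have h0 : β ≠ 0 := by rintro rfl; simp at hβ
  rw [inv_re]; exact div_pos hβ (normSq_pos.2 h0)

theorem ne_zero_of_re_pos {β : ℂ} (hβ : 0 < β.re) : β ≠ 0 := by rintro rfl; simp at hβ

theorem norm_borel_mul_exp_le {C : ℝ} (hC : ∀ t : ℂ, ‖borel t‖ ≤ C * ‖t‖ ^ 4) {p : ℂ} {c t : ℝ}
    (hC0 : 0 < C) (hc : c ≤ p.re) (ht : 0 < t) :
    ‖borel t * cexp (-(p * t))‖ ≤ C * (t ^ 4 * Real.exp (-(c * t))) := by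
  have h := hC t
  rw [norm_real, Real.norm_of_nonneg ht.le] at h
  rw [norm_mul, norm_cexp_neg_mul, ← mul_assoc]
  gcongr

theorem aestronglyMeasurable_borel_mul_exp (p : ℂ) :
    AEStronglyMeasurable (fun t : ℝ => borel t * cexp (-(p * t))) (volume.restrict (Set.Ioi 0)) :=
  ContinuousOn.aestronglyMeasurable
    ((continuousOn_borel_ofReal.mono Set.Ioi_subset_Ici_self).mul (by fun_prop)) measurableSet_Ioi

theorem integrableOn_borel_mul_exp {p : ℂ} (hp : 0 < p.re) :
    IntegrableOn (fun t : ℝ => borel t * cexp (-(p * t))) (Set.Ioi 0) := by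
  obtain ⟨C, hC0, hC⟩ := exists_norm_borel_le
  exact integrableOn_of_norm_le_pow_mul_exp hp (aestronglyMeasurable_borel_mul_exp p)
    fun t ht => norm_borel_mul_exp_le hC hC0 le_rfl ht

theorem differentiableAt_laplaceBorel {β : ℂ} (hβ : 0 < β.re) :
    DifferentiableAt ℂ laplaceBorel β := by
  obtain ⟨C, hC0, hC⟩ := exists_norm_borel_le
  have hβ0 := ne_zero_of_re_pos hβ
  have hp : DifferentiableAt ℂ (fun p : ℂ => ∫ t in Set.Ioi (0 : ℝ), borel t * cexp (-(p * t)))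
      β⁻¹ := by
    set c := (β⁻¹).re / 2 with hc
    have hc0 : 0 < c := half_pos (inv_re_pos hβ)
    have hopen : IsOpen {z : ℂ | c < z.re} := isOpen_lt continuous_const continuous_re
    obtain ⟨r, hr, hball⟩ := Metric.isOpen_iff.1 hopen β⁻¹
      (show c < (β⁻¹).re by linarith)
    refine differentiableAt_integral_of_dominated
      (F := fun p (t : ℝ) => borel t * cexp (-(p * t)))
      (b := fun t => C * (t ^ 4 * Real.exp (-(c * t)))) hr
      (fun z _ => aestronglyMeasurable_borel_mul_exp z) ?_ ?_
      ((integrableOn_pow_mul_exp_neg_mul 4 hc0).const_mul _)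
    · filter_upwards with t
      fun_prop
    · filter_upwards [ae_restrict_mem measurableSet_Ioi] with t ht z hz
      exact norm_borel_mul_exp_le hC hC0 (hball hz).le ht
  have hinv : DifferentiableAt ℂ (fun β : ℂ => β⁻¹) β := differentiableAt_inv hβ0
  exact hinv.mul (DifferentiableAt.fun_comp' (f := fun β : ℂ => β⁻¹) β hp hinv)

theorem div_pole_re_pos {β : ℂ} (hβ : 0 < β.re) (k : ℕ) : 0 < (β / pole k).re := by
  rw [div_ofReal_re]; exact div_pos hβ (pole_pos k)

theorem norm_div_pole (β : ℂ) (k : ℕ) : ‖β / (pole k : ℂ)‖ = ‖β‖ * (pole k)⁻¹ := by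
  rw [norm_div, norm_real, Real.norm_of_nonneg (pole_pos k).le, div_eq_mul_inv]

/-- Dividing by the positive number `p_k` does not change the aperture, so the constants of the
oscillating estimates are uniform in `k`. -/
theorem aperture_div_pole (β : ℂ) (k : ℕ) :
    2 * ‖β / (pole k : ℂ)‖ ^ 2 / (β / pole k).re ^ 2 = 2 * ‖β‖ ^ 2 / β.re ^ 2 := by
  have := (pole_pos k).ne'
  rw [norm_div_pole, div_ofReal_re]
  field_simp

/-- The oscillating integral to which the Laplace transform of the kernel is rotated. -/
def oscLimit (w : ℂ) : ℂ := ∫ s in Set.Ioi (0 : ℝ), kernel₄ (I * w * s) * cexp (-(I * s))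

theorem integral_kernel_div_pole {β : ℂ} (hβ : 0 < β.re) (k : ℕ) :
    β⁻¹ * ∫ t in Set.Ioi (0 : ℝ), kernel (t / pole k) * cexp (-(β⁻¹ * t))
      = I * (β / pole k) ^ 4 * oscLimit (β / pole k) := by
  have hk := pole_pos k
  have hkC : (pole k : ℂ) ≠ 0 := by exact_mod_cast hk.ne'
  have hβ0 := ne_zero_of_re_pos hβ
  have h := integral_comp_mul_left_Ioi'
    (fun t : ℝ => kernel (t / pole k) * cexp (-(β⁻¹ * t))) 0 hk
  rw [mul_zero] at h
  rw [← h]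
  have h2 : ∫ x in Set.Ioi (0 : ℝ), kernel (((pole k * x : ℝ) : ℂ) / pole k) *
      cexp (-(β⁻¹ * ((pole k * x : ℝ) : ℂ)))
      = ∫ x in Set.Ioi (0 : ℝ), kernel x * cexp (-((β / pole k)⁻¹ * x)) := by
    refine setIntegral_congr_fun measurableSet_Ioi fun x _ => ?_
    simp only [ofReal_mul]
    rw [mul_div_cancel_left₀ _ hkC, inv_div]
    congr 3
    field_simp
  rw [h2, integral_kernel_mul_exp (div_pole_re_pos hβ k), real_smul, oscLimit]
  field_simp

/-- The quartic bound dominates the summands by `p_k⁻⁴` times an integrable function, so sum and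
Laplace integral commute. -/
theorem hasSum_laplaceBorel {β : ℂ} (hβ : 0 < β.re) :
    HasSum (fun k => -(1 / (4 * (Real.pi : ℂ) ^ 2)) *
      (I * (β / pole k) ^ 4 * oscLimit (β / pole k))) (laplaceBorel β) := by
  obtain ⟨C, hC0, hC⟩ := exists_norm_kernel_le
  have hp := inv_re_pos hβ
  set b : ℕ → ℝ → ℝ := fun k t => (pole k)⁻¹ ^ 4 * (C * (t ^ 4 * Real.exp (-((β⁻¹).re * t)))) with hb
  have hS := summable_inv_pole_pow (m := 4) (by norm_num)
  have h := hasSum_integral_of_dominated_convergence (μ := volume.restrict (Set.Ioi (0 : ℝ)))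
    (F := fun k (t : ℝ) => kernel (t / pole k) * cexp (-(β⁻¹ * t)))
    (f := fun t : ℝ => (∑' k, kernel (t / pole k)) * cexp (-(β⁻¹ * t))) b ?_ ?_ ?_ ?_ ?_
  · refine HasSum.congr_of_eq (h.mul_left (-(1 / (4 * (Real.pi : ℂ) ^ 2)) * β⁻¹)) (fun k => ?_) ?_
    · rw [← integral_kernel_div_pole hβ k]; ring
    · rw [laplaceBorel]
      simp only [borel]
      rw [← integral_const_mul, ← integral_const_mul]
      congr 1; ext t; ring
  · intro k
    refine ContinuousOn.aestronglyMeasurable (ContinuousOn.mul ?_ (by fun_prop)) measurableSet_Ioi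
    have hc : ContinuousOn (fun t : ℝ => kernel ((t / pole k : ℝ) : ℂ)) (Set.Ioi 0) :=
      continuousOn_kernel_ofReal.comp (f := fun t : ℝ => t / pole k) (by fun_prop) fun t ht =>
        div_nonneg (le_of_lt ht) (pole_pos k).le
    simpa using hc
  · intro k
    filter_upwards [ae_restrict_mem measurableSet_Ioi] with t ht
    have ht0 : (0 : ℝ) < t := ht
    have h1 := norm_kernel_div_pole_le hC t k
    rw [norm_real, Real.norm_of_nonneg ht0.le] at h1
    rw [norm_mul, norm_cexp_neg_mul]
    calc _ ≤ (C * t ^ 4 * (pole k)⁻¹ ^ 4) * Real.exp (-((β⁻¹).re * t)) := by gcongr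
      _ = _ := by rw [hb]; ring
  · filter_upwards with t
    exact hS.mul_right _
  · simp only [hb, tsum_mul_right]
    exact ((integrableOn_pow_mul_exp_neg_mul 4 hp).const_mul C).const_mul _
  · filter_upwards with t
    exact (summable_kernel_div_pole t).hasSum.mul_right _

/-! ### The effective action as a sum of oscillating integrals -/

/-- Partial fractions of `π z cot(π z)` at `z = ix/π`. Subtracting `x²/3 = (2x²/π²) ζ(2)` termwise
turns `2v/(1 + v)` into `2v/(1 + v) - 2v = -2v²/(1 + v)`, of order `k⁻⁴`. -/
theorem hasSum_xcoth {x : ℂ} (hx : 0 < x.re) :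
    HasSum (fun k : ℕ => -2 * (x ^ 2 / (Real.pi ^ 2 * ((k : ℂ) + 1) ^ 2)) ^ 2 /
      (1 + x ^ 2 / (Real.pi ^ 2 * ((k : ℂ) + 1) ^ 2))) (xcoth x - 1 - x ^ 2 / 3) := by
  have hpi : (Real.pi : ℂ) ≠ 0 := by exact_mod_cast Real.pi_ne_zero
  have hx0 := ne_zero_of_re_pos hx
  set z : ℂ := x * I / Real.pi with hz
  have him : 0 < z.im := by
    rw [hz, div_ofReal_im]
    simpa using div_pos hx Real.pi_pos
  have hzc : z ∈ integerComplement := UpperHalfPlane.coe_mem_integerComplement ⟨z, him⟩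
  have hz0 : z ≠ 0 := integerComplement.ne_zero hzc
  have hpz : Real.pi * z = x * I := by rw [hz]; field_simp
  have hzsq : z ^ 2 = -(x ^ 2 / Real.pi ^ 2) := by
    rw [hz, div_pow, mul_pow, I_sq]; ring
  have hsum : HasSum (fun n : ℕ => (1 / (z - (n + 1)) + 1 / (z + (n + 1))))
      (Real.pi * cot (Real.pi * z) - 1 / z) := by
    rw [cot_series_rep' hzc]
    exact (summable_cotTerm hzc).hasSum
  have h6 : HasSum (fun k : ℕ => (((k : ℂ) + 1) ^ 2)⁻¹) ((Real.pi : ℂ) ^ 2 / 6) := by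
    have h := (hasSum_nat_add_iff' 1).2 hasSum_zeta_two
    have h' : HasSum (fun k : ℕ => (((k : ℝ) + 1) ^ 2)⁻¹) (Real.pi ^ 2 / 6) := by simpa using h
    have h3 := Complex.hasSum_ofReal.2 h'
    push_cast at h3
    exact h3
  have h := (hsum.mul_left z).sub (h6.mul_left (2 * x ^ 2 / Real.pi ^ 2))
  refine HasSum.congr_of_eq h (fun k => ?_) ?_
  · have e1 : z - (k + 1) ≠ 0 := by
      have := integerComplement_add_ne_zero hzc (-(k + 1 : ℤ))
      push_cast at this
      rwa [sub_eq_add_neg]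
    have e2 : z + (k + 1) ≠ 0 := by
      have := integerComplement_add_ne_zero hzc (k + 1 : ℤ)
      push_cast at this
      exact this
    have e3 : ((k : ℂ) + 1) ≠ 0 := by exact_mod_cast k.succ_ne_zero
    have e4 : x ^ 2 / Real.pi ^ 2 = -z ^ 2 := by rw [hzsq, neg_neg]
    have e5 : 1 + -z ^ 2 / ((k : ℂ) + 1) ^ 2 ≠ 0 := by
      intro h0
      field_simp at h0
      have : (z - (k + 1)) * (z + (k + 1)) = 0 := by linear_combination -h0
      exact (mul_ne_zero e1 e2) this
    have e6 : ((k : ℂ) + 1) ^ 2 - z ^ 2 ≠ 0 := by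
      have : ((k : ℂ) + 1) ^ 2 - z ^ 2 = -((z - (k + 1)) * (z + (k + 1))) := by ring
      rw [this]
      exact neg_ne_zero.2 (mul_ne_zero e1 e2)
    rw [← div_div, mul_div_assoc 2, e4]
    rw [show 1 + -z ^ 2 / ((k : ℂ) + 1) ^ 2 = (((k : ℂ) + 1) ^ 2 - z ^ 2) / ((k : ℂ) + 1) ^ 2 by
      field_simp; ring]
    field_simp
    ring
  · rw [xcoth, if_neg hx0, hpz, Complex.cot, cos_mul_I, sin_mul_I, mul_sub, mul_one_div_cancel hz0]
    have : z * (Real.pi * (cosh x / (sinh x * I))) = x * (cosh x / sinh x) := by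
      rw [show z * (Real.pi * (cosh x / (sinh x * I))) = (Real.pi * z) * (cosh x / (sinh x * I)) by
        ring, hpz, ← div_div, mul_assoc, mul_div_cancel₀ _ I_ne_zero]
    rw [this]
    field_simp
    ring

/-- The `k`-th summand of the integrand, without its constant factor. -/
def oscTerm (w : ℂ) (s : ℝ) : ℂ := cexp (-(I * s)) * ((s : ℂ) / (1 + w ^ 2 * (s : ℂ) ^ 2))

theorem hasSum_integrand {β : ℂ} (hβ : 0 < β.re) {s : ℝ} (hs : 0 ≤ s) :
    HasSum (fun k => -2 * (β / pole k) ^ 4 * oscTerm (β / pole k) s) (integrand (β ^ 2) s) := by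
  rcases eq_or_lt_of_le hs with rfl | hs
  -- Division by zero makes the integrand `0` at `s = 0`; this is also its limit, since the bracket
  -- is of order `s⁴`.
  · simp [oscTerm, integrand]
  have hpi := Real.pi_pos
  have hpiC : (Real.pi : ℂ) ≠ 0 := by exact_mod_cast Real.pi_ne_zero
  have hsC : (s : ℂ) ≠ 0 := by exact_mod_cast hs.ne'
  have hsq : ((√Real.pi : ℝ) : ℂ) ^ 2 = Real.pi := by
    rw [← ofReal_pow, Real.sq_sqrt hpi.le]
  have hroot : ((Real.pi : ℂ) * β ^ 2) ^ (1 / 2 : ℂ) = (√Real.pi : ℝ) * β := by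
    rw [← hsq, ← mul_pow, one_div]
    refine sq_cpow_two_inv ?_
    rw [re_ofReal_mul]
    exact mul_pos (Real.sqrt_pos.2 hpi) hβ
  set x : ℂ := 2 * ((√Real.pi : ℝ) * β) * s with hx
  have hxre : 0 < x.re := by
    rw [show x = ((2 * √Real.pi * s : ℝ) : ℂ) * β by rw [hx]; push_cast; ring, re_ofReal_mul]
    have := Real.sqrt_pos.2 hpi
    positivity
  have hxsq : x ^ 2 = 4 * Real.pi * β ^ 2 * s ^ 2 := by
    rw [hx, ← hsq]; ring
  have h := (hasSum_xcoth hxre).mul_left (cexp (-I * s) / (s : ℂ) ^ 3)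
  refine HasSum.congr_of_eq h (fun k => ?_) ?_
  · have hv : x ^ 2 / (Real.pi ^ 2 * ((k : ℂ) + 1) ^ 2) = (β / pole k) ^ 2 * (s : ℂ) ^ 2 := by
      have h2 : (pole k : ℂ) ^ 2 = ((k : ℂ) + 1) ^ 2 * (Real.pi / 4) := by
        exact_mod_cast congrArg (fun r : ℝ => (r : ℂ)) (pole_sq k)
      have e3 : ((k : ℂ) + 1) ≠ 0 := by exact_mod_cast k.succ_ne_zero
      rw [hxsq, div_pow, h2]
      field_simp
    have h0 := one_add_sq_mul_sq_ne_zero (div_pole_re_pos hβ k) s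
    rw [hv, oscTerm, neg_mul I]
    field_simp
  · rw [integrand, hroot, hxsq]

theorem continuous_oscTerm {w : ℂ} (hw : 0 < w.re) : Continuous (oscTerm w) :=
  Continuous.mul (by fun_prop) (Continuous.div (by fun_prop) (by fun_prop)
    (one_add_sq_mul_sq_ne_zero hw))

theorem norm_oscTerm_le {w : ℂ} (hw : 0 < w.re) {s T : ℝ} (hs : 0 ≤ s) (hT : s ≤ T) :
    ‖oscTerm w s‖ ≤ 2 * ‖w‖ ^ 2 / w.re ^ 2 * T := by
  rw [oscTerm, norm_mul, norm_cexp_neg_mul]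
  simp only [I_re, zero_mul, neg_zero, Real.exp_zero, one_mul]
  refine (norm_div_one_add_le hw hs).trans ?_
  gcongr
  exact (div_le_self hs (by nlinarith [sq_nonneg (‖w‖ * s)])).trans hT

theorem norm_term_le {β : ℂ} (hβ : 0 < β.re) (k : ℕ) {s T : ℝ} (hs : 0 ≤ s) (hT : s ≤ T) :
    ‖-2 * (β / pole k) ^ 4 * oscTerm (β / pole k) s‖
      ≤ 2 * ‖β‖ ^ 4 * (2 * ‖β‖ ^ 2 / β.re ^ 2 * T) * (pole k)⁻¹ ^ 4 := by
  have h := norm_oscTerm_le (div_pole_re_pos hβ k) hs hT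
  rw [aperture_div_pole] at h
  rw [norm_mul, norm_mul, norm_pow, norm_div_pole, norm_neg, mul_pow]
  norm_num only [norm_ofNat]
  calc _ ≤ 2 * (‖β‖ ^ 4 * (pole k)⁻¹ ^ 4) * (2 * ‖β‖ ^ 2 / β.re ^ 2 * T) := by
        have := pole_pos k
        gcongr
    _ = _ := by ring

theorem intervalIntegrable_integrand {β : ℂ} (hβ : 0 < β.re) {T : ℝ} (hT : 0 ≤ T) :
    IntervalIntegrable (integrand (β ^ 2)) volume 0 T := by
  have hc : ContinuousOn (fun s => ∑' k, -2 * (β / pole k) ^ 4 * oscTerm (β / pole k) s)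
      (Set.uIcc 0 T) := by
    rw [Set.uIcc_of_le hT]
    refine continuousOn_tsum
      (fun k => (continuous_const.mul (continuous_oscTerm (div_pole_re_pos hβ k))).continuousOn)
      ((summable_inv_pole_pow (m := 4) (by norm_num)).mul_left
        (2 * ‖β‖ ^ 4 * (2 * ‖β‖ ^ 2 / β.re ^ 2 * T))) fun k s hs => norm_term_le hβ k hs.1 hs.2
  refine hc.intervalIntegrable.congr fun s hs => ?_
  rw [Set.uIoc_of_le hT] at hs
  exact (hasSum_integrand hβ hs.1.le).tsum_eq

theorem hasSum_actionUpTo {β : ℂ} (hβ : 0 < β.re) {T : ℝ} (hT : 0 ≤ T) :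
    HasSum (fun k => (1 / (4 * (Real.pi : ℂ) ^ 2)) * (β / pole k) ^ 4 *
      ∫ s in (0 : ℝ)..T, oscTerm (β / pole k) s) (actionUpTo (β ^ 2) T) := by
  have hS := (summable_inv_pole_pow (m := 4) (by norm_num)).mul_left
    (2 * ‖β‖ ^ 4 * (2 * ‖β‖ ^ 2 / β.re ^ 2 * T))
  have h := intervalIntegral.hasSum_integral_of_dominated_convergence (μ := volume) (a := 0) (b := T)
    (F := fun k s => -2 * (β / pole k) ^ 4 * oscTerm (β / pole k) s) (f := integrand (β ^ 2))
    (fun k _ => 2 * ‖β‖ ^ 4 * (2 * ‖β‖ ^ 2 / β.re ^ 2 * T) * (pole k)⁻¹ ^ 4)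
    (fun k => (continuous_const.mul
      (continuous_oscTerm (div_pole_re_pos hβ k))).aestronglyMeasurable) ?_ ?_
    intervalIntegrable_const ?_
  · refine HasSum.congr_of_eq (h.mul_left (-(1 / (8 * (Real.pi : ℂ) ^ 2)))) (fun k => ?_) rfl
    rw [intervalIntegral.integral_const_mul]
    ring
  · intro k
    filter_upwards with s hs
    rw [Set.uIoc_of_le hT] at hs
    exact norm_term_le hβ k hs.1.le hs.2
  · filter_upwards with s _
    exact hS
  · filter_upwards with s hs
    rw [Set.uIoc_of_le hT] at hs
    exact hasSum_integrand hβ hs.1.le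

/-- Dominated convergence over the poles with majorant of order `p_k⁻³`; the limiting series is then
term by term that of `hasSum_laplaceBorel`. -/
theorem tendsto_actionUpTo_sq {β : ℂ} (hβ : 0 < β.re) :
    Tendsto (actionUpTo (β ^ 2)) atTop (𝓝 (laplaceBorel β)) := by
  have hβn : 0 < ‖β‖ := norm_pos_iff.2 (ne_zero_of_re_pos hβ)
  set A := 2 * ‖β‖ ^ 2 / β.re ^ 2 with hA
  have h := tendsto_tsum_of_dominated_convergence (𝓕 := atTop)
    (f := fun (T : ℝ) k => (1 / (4 * (Real.pi : ℂ) ^ 2)) * (β / pole k) ^ 4 *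
      ∫ s in (0 : ℝ)..T, oscTerm (β / pole k) s)
    (g := fun k => (1 / (4 * (Real.pi : ℂ) ^ 2)) * (β / pole k) ^ 4 *
      (-I * oscLimit (β / pole k)))
    (bound := fun k => ‖(1 / (4 * (Real.pi : ℂ) ^ 2))‖ * ‖β‖ ^ 3 * (A + 2 * A ^ 2)
      * (pole k)⁻¹ ^ 3)
    ((summable_inv_pole_pow (m := 3) (by norm_num)).mul_left _) ?_ ?_
  · have h2 : (∑' k, (1 / (4 * (Real.pi : ℂ) ^ 2)) * (β / pole k) ^ 4 *
        (-I * oscLimit (β / pole k))) = laplaceBorel β := by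
      rw [← (hasSum_laplaceBorel hβ).tsum_eq]
      exact tsum_congr fun k => by ring
    rw [h2] at h
    refine h.congr' ?_
    filter_upwards [eventually_ge_atTop 0] with T hT
    exact (hasSum_actionUpTo hβ hT).tsum_eq
  · intro k
    exact (tendsto_integral_osc (div_pole_re_pos hβ k)).const_mul _
  · filter_upwards [eventually_ge_atTop 0] with T hT k
    have h1 := norm_integral_osc_le (div_pole_re_pos hβ k) hT
    rw [aperture_div_pole, ← hA, norm_div_pole] at h1
    have hk := pole_pos k
    rw [norm_mul, norm_mul, norm_pow, norm_div_pole]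
    calc _ ≤ ‖(1 / (4 * (Real.pi : ℂ) ^ 2))‖ * (‖β‖ * (pole k)⁻¹) ^ 4 *
          ((A + 2 * A ^ 2) / (‖β‖ * (pole k)⁻¹)) := by gcongr; exact h1
      _ = _ := by field_simp

/-! ### Convergence and analyticity of `S` on the slit plane. -/

theorem S_sq {β : ℂ} (hβ : 0 < β.re) : S (β ^ 2) = laplaceBorel β :=
  (tendsto_actionUpTo_sq hβ).limUnder_eq

/-- Halving an argument in `(-π, π)` lands in the right half-plane. -/
theorem exists_sqrt {α : ℂ} (hα : α ∈ slitPlane) :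
    0 < (α ^ (2⁻¹ : ℂ)).re ∧ (α ^ (2⁻¹ : ℂ)) ^ 2 = α := by
  have h0 := slitPlane_ne_zero hα
  refine ⟨?_, by simp⟩
  rw [cpow_def_of_ne_zero h0, exp_re]
  refine mul_pos (Real.exp_pos _) (Real.cos_pos_of_mem_Ioo ?_)
  have h1 : (log α * 2⁻¹).im = α.arg / 2 := by
    rw [show (2⁻¹ : ℂ) = ((2⁻¹ : ℝ) : ℂ) by push_cast; rfl, im_mul_ofReal, log_im]; ring
  rw [h1]
  have h2 := neg_pi_lt_arg α
  have h3 := lt_of_le_of_ne (arg_le_pi α) (mem_slitPlane_iff_arg.1 hα).1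
  constructor <;> linarith

theorem S_eq_laplaceBorel {α : ℂ} (hα : α ∈ slitPlane) : S α = laplaceBorel (α ^ (2⁻¹ : ℂ)) := by
  obtain ⟨h1, h2⟩ := exists_sqrt hα
  conv_lhs => rw [← h2]
  exact S_sq h1

theorem converges {α : ℂ} (hα : α ∈ slitPlane) :
    (∀ T : ℝ, 0 ≤ T → IntervalIntegrable (integrand α) volume 0 T) ∧
      Tendsto (actionUpTo α) atTop (𝓝 (S α)) := by
  obtain ⟨h1, h2⟩ := exists_sqrt hα
  rw [← h2]
  refine ⟨fun T hT => intervalIntegrable_integrand h1 hT, ?_⟩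
  rw [S_sq h1]
  exact tendsto_actionUpTo_sq h1

theorem analyticOnNhd_S : AnalyticOnNhd ℂ S slitPlane := by
  refine DifferentiableOn.analyticOnNhd (fun α hα => ?_) isOpen_slitPlane
  obtain ⟨h1, _⟩ := exists_sqrt hα
  have h2 : DifferentiableAt ℂ (fun α : ℂ => α ^ (2⁻¹ : ℂ)) α :=
    differentiableAt_id.cpow_const hα
  have h3 := DifferentiableAt.fun_comp' (f := fun α : ℂ => α ^ (2⁻¹ : ℂ)) α
    (differentiableAt_laplaceBorel h1) h2
  refine DifferentiableAt.differentiableWithinAt (h3.congr_of_eventuallyEq ?_)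
  filter_upwards [isOpen_slitPlane.mem_nhds hα] with z hz using S_eq_laplaceBorel hz

/-- The origin lies outside the slit plane, so it is treated directly: `0 ^ (1/2) = 0` and `xcoth 0
= 1` make the integrand vanish identically. -/
theorem S_zero : S 0 = 0 := by
  have h : actionUpTo 0 = fun _ => 0 := by
    ext T
    have : integrand 0 = fun _ => 0 := by
      ext s
      simp [integrand, xcoth]
    simp [actionUpTo, this]
  rw [S, h]
  exact tendsto_const_nhds.limUnder_eq

theorem half_add_conj_S {α : ℝ} :
    (S α + conj (S (conj (α : ℂ)))) / 2 = ((S α).re : ℂ) := by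
  rw [conj_ofReal, re_eq_add_conj]

/-! ### The perturbation expansion -/

theorem sum_coeff_mul_sq_pow (β : ℂ) (N : ℕ) :
    ∑ n ∈ Finset.range N, coeff n * (β ^ 2) ^ n
      = ∑ j ∈ Finset.range (2 * N), sqrtSeries coeff j * β ^ j := by
  induction N with
  | zero => simp
  | succ N ih =>
    rw [Finset.sum_range_succ, ih, show 2 * (N + 1) = 2 * N + 1 + 1 by ring,
      Finset.sum_range_succ, Finset.sum_range_succ, add_assoc]
    congr 1
    have ho : ¬ Even (2 * N + 1) := by simp
    simp [sqrtSeries, ho, pow_mul]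

/-- Watson's lemma: the polynomial is the Laplace integral of the Taylor polynomial of `borel`.
Keeping `Re β⁻¹` explicit leaves the choice of sector open. -/
theorem exists_norm_laplaceBorel_sub_le {N : ℕ} (hN : 2 ≤ N) : ∃ C : ℝ, ∀ β : ℂ, 0 < β.re →
    ‖laplaceBorel β - ∑ n ∈ Finset.range N, coeff n * (β ^ 2) ^ n‖
      ≤ C * ‖β‖⁻¹ * ((β⁻¹).re ^ (2 * N + 1))⁻¹ := by
  obtain ⟨C, hC0, hC⟩ := exists_norm_borel_sub_sum_le (M := 2 * N) (by omega)
  refine ⟨C * (2 * N).factorial, fun β hβ => ?_⟩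
  have hp := inv_re_pos hβ
  have hβ0 := ne_zero_of_re_pos hβ
  have hterm : ∀ j : ℕ, IntegrableOn (fun t : ℝ => sqrtSeries coeff j / (j.factorial : ℂ) *
      ((t : ℂ) ^ j * cexp (-(β⁻¹ * t)))) (Set.Ioi 0) := fun j =>
    (integrableOn_pow_mul_cexp_neg_mul j hp).const_mul _
  have hsum : ∑ n ∈ Finset.range N, coeff n * (β ^ 2) ^ n
      = ∑ j ∈ Finset.range (2 * N), sqrtSeries coeff j * β ^ j :=
    sum_coeff_mul_sq_pow β N
  have hint : ∑ j ∈ Finset.range (2 * N), sqrtSeries coeff j * β ^ j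
      = β⁻¹ * ∫ t in Set.Ioi (0 : ℝ), ∑ j ∈ Finset.range (2 * N),
        sqrtSeries coeff j / (j.factorial : ℂ) * ((t : ℂ) ^ j * cexp (-(β⁻¹ * t))) := by
    rw [integral_finsetSum _ fun j _ => hterm j, Finset.mul_sum]
    refine Finset.sum_congr rfl fun j _ => ?_
    have hj : (j.factorial : ℂ) ≠ 0 := by exact_mod_cast j.factorial_ne_zero
    rw [integral_const_mul, integral_pow_mul_cexp_neg_mul j hp, inv_pow, div_inv_eq_mul]
    field_simp
    ring
  rw [hsum, hint, laplaceBorel, ← mul_sub,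
    ← integral_sub (integrableOn_borel_mul_exp hp) (integrable_finsetSum _ fun j _ => hterm j),
    norm_mul, norm_inv]
  have hb : ‖∫ t in Set.Ioi (0 : ℝ), (borel t * cexp (-(β⁻¹ * t)) - ∑ j ∈ Finset.range (2 * N),
        sqrtSeries coeff j / (j.factorial : ℂ) * ((t : ℂ) ^ j * cexp (-(β⁻¹ * t))))‖
      ≤ ∫ t in Set.Ioi (0 : ℝ), C * (t ^ (2 * N) * Real.exp (-((β⁻¹).re * t))) := by
    refine norm_integral_le_of_norm_le ((integrableOn_pow_mul_exp_neg_mul _ hp).const_mul C) ?_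
    filter_upwards [ae_restrict_mem measurableSet_Ioi] with t ht
    have ht0 : (0 : ℝ) < t := ht
    have h1 := hC t
    rw [norm_real, Real.norm_of_nonneg ht0.le] at h1
    have h2 : borel t * cexp (-(β⁻¹ * t)) - ∑ j ∈ Finset.range (2 * N),
        sqrtSeries coeff j / (j.factorial : ℂ) * ((t : ℂ) ^ j * cexp (-(β⁻¹ * t)))
        = (borel t - ∑ j ∈ Finset.range (2 * N),
          sqrtSeries coeff j / (j.factorial : ℂ) * (t : ℂ) ^ j) * cexp (-(β⁻¹ * t)) := by
      rw [sub_mul, Finset.sum_mul]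
      congr 1
      exact Finset.sum_congr rfl fun j _ => by ring
    rw [h2, norm_mul, norm_cexp_neg_mul, ← mul_assoc]
    gcongr
  rw [integral_const_mul, integral_pow_mul_exp_neg_mul _ hp] at hb
  calc _ ≤ ‖β‖⁻¹ * (C * ((2 * N).factorial / (β⁻¹).re ^ (2 * N + 1))) := by gcongr
    _ = _ := by ring

theorem expansion_of_two_le {N : ℕ} (hN : 2 ≤ N) :
    (fun α : ℂ => S α - ∑ n ∈ Finset.range N, coeff n * α ^ n)
      =O[𝓝[{α : ℂ | 0 < α.re}] 0] (fun α : ℂ => α ^ N) := by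
  obtain ⟨C, hC⟩ := exists_norm_laplaceBorel_sub_le hN
  refine IsBigO.of_bound (|C| * 2 ^ (2 * N + 1)) ?_
  filter_upwards [self_mem_nhdsWithin] with α hα
  have hα' : 0 < α.re := hα
  have hs : α ∈ slitPlane := Or.inl hα'
  obtain ⟨h1, h2⟩ := exists_sqrt hs
  rw [S_eq_laplaceBorel hs]
  set β := α ^ (2⁻¹ : ℂ) with hβ
  rw [← h2]
  have hβn : 0 < ‖β‖ := norm_pos_iff.2 (ne_zero_of_re_pos h1)
  -- For `Re α > 0` the root satisfies `|arg β| < π/4`, which makes `Re β⁻¹` comparable to `‖β‖⁻¹`.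
  have hsq : β.im ^ 2 ≤ β.re ^ 2 := by
    have : (β ^ 2).re = β.re ^ 2 - β.im ^ 2 := by rw [sq, mul_re]; ring
    rw [h2] at this
    linarith
  have hre : ‖β‖ / 2 ≤ β.re := by
    have h3 : ‖β‖ ^ 2 = β.re ^ 2 + β.im ^ 2 := by
      rw [← normSq_eq_norm_sq, normSq_apply]; ring
    have h4 : (‖β‖ / 2) ^ 2 ≤ β.re ^ 2 := by nlinarith
    exact abs_le_of_sq_le_sq' h4 h1.le |>.2
  have hinv : (2 * ‖β‖)⁻¹ ≤ (β⁻¹).re := by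
    rw [inv_re, normSq_eq_norm_sq, le_div_iff₀ (by positivity)]
    calc (2 * ‖β‖)⁻¹ * ‖β‖ ^ 2 = ‖β‖ / 2 := by field_simp
      _ ≤ β.re := hre
  refine (hC β h1).trans ?_
  calc C * ‖β‖⁻¹ * ((β⁻¹).re ^ (2 * N + 1))⁻¹
      ≤ |C| * ‖β‖⁻¹ * (((2 * ‖β‖)⁻¹) ^ (2 * N + 1))⁻¹ := by
        have hCle := le_abs_self C
        have hp := inv_re_pos h1
        gcongr
    _ = |C| * 2 ^ (2 * N + 1) * ‖(β ^ 2) ^ N‖ := by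
        rw [inv_pow, inv_inv, mul_pow, pow_succ ‖β‖, norm_pow, norm_pow, ← pow_mul]
        field_simp

theorem expansion (N : ℕ) :
    (fun α : ℂ => S α - ∑ n ∈ Finset.range N, coeff n * α ^ n)
      =O[𝓝[{α : ℂ | 0 < α.re}] 0] (fun α : ℂ => α ^ N) := by
  rcases le_or_gt 2 N with h | h
  · exact expansion_of_two_le h
  -- The coefficients with `n < 2` vanish, so the cases `N < 2` follow from `N = 2`.
  · have h2 := expansion_of_two_le (N := 2) le_rfl
    have hz : ∀ M ≤ 2, ∀ α : ℂ, ∑ n ∈ Finset.range M, coeff n * α ^ n = 0 := by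
      intro M hM α
      refine Finset.sum_eq_zero fun n hn => ?_
      rw [Finset.mem_range] at hn
      rw [coeff, a, if_pos (by omega)]; simp
    simp only [hz 2 le_rfl, hz N h.le] at h2 ⊢
    refine h2.trans (IsBigO.of_bound 1 ?_)
    have hb : ∀ᶠ α : ℂ in 𝓝[{α : ℂ | 0 < α.re}] 0, ‖α‖ < 1 := by
      refine nhdsWithin_le_nhds ?_
      filter_upwards [Metric.ball_mem_nhds (0 : ℂ) one_pos] with α hα
      simpa using hα
    filter_upwards [hb] with α hα
    rw [norm_pow, norm_pow, one_mul]
    exact pow_le_pow_of_le_one (norm_nonneg _) hα.le h.le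

/-! ### The boundary value as a distribution -/

/-- The boundary value `B(t + i0)` of the Borel transform, as a distribution carried by
`[0, ∞)`. -/
def borelDist : 𝓓'((⊤ : TopologicalSpace.Opens ℝ), ℂ) :=
  (TestFunction.integralAgainstBilinCLM (ContinuousLinearMap.lsmul ℝ ℝ)
    (volume.restrict (Set.Ioi 0)) (fun t : ℝ => borel t) :
      𝓓((⊤ : TopologicalSpace.Opens ℝ), ℝ) →L[ℝ] ℂ)

theorem locallyIntegrableOn_borel :
    LocallyIntegrableOn (fun t : ℝ => borel t) ((⊤ : TopologicalSpace.Opens ℝ) : Set ℝ)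
      (volume.restrict (Set.Ioi 0)) := by
  obtain ⟨C, hC0, hC⟩ := exists_norm_borel_le
  have h1 : LocallyIntegrable (fun t : ℝ => C * ‖(t : ℂ)‖ ^ 4) (volume.restrict (Set.Ioi 0)) :=
    (by fun_prop : Continuous fun t : ℝ => C * ‖(t : ℂ)‖ ^ 4).locallyIntegrable
  refine (h1.mono ?_ ?_).locallyIntegrableOn _
  · exact ContinuousOn.aestronglyMeasurable
      (continuousOn_borel_ofReal.mono Set.Ioi_subset_Ici_self) measurableSet_Ioi
  · filter_upwards with t
    exact (hC t).trans (le_abs_self _)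

theorem borelDist_apply (φ : 𝓓((⊤ : TopologicalSpace.Opens ℝ), ℝ)) :
    borelDist φ = ∫ t in Set.Ioi (0 : ℝ), borel t * (φ t : ℂ) := by
  have h := TestFunction.integralAgainstBilinCLM_eq_integral
    (B := ContinuousLinearMap.lsmul ℝ ℝ) locallyIntegrableOn_borel (f := φ)
  refine Eq.trans h ?_
  congr 1; ext t
  simp [mul_comm]

theorem integrableOn_borel_mul (φ : 𝓓((⊤ : TopologicalSpace.Opens ℝ), ℝ)) :
    IntegrableOn (fun t : ℝ => borel t * (φ t : ℂ)) (Set.Ioi 0) := by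
  have h := TestFunction.integrable_bilin (ContinuousLinearMap.lsmul ℝ ℝ)
    locallyIntegrableOn_borel φ
  refine Integrable.congr h ?_
  filter_upwards with t
  simp [mul_comm]

theorem pair_borelDist (ψ : 𝓓((⊤ : TopologicalSpace.Opens ℝ), ℂ)) :
    pair borelDist ψ = ∫ t in Set.Ioi (0 : ℝ), borel t * ψ t := by
  rw [pair, borelDist_apply, borelDist_apply, ← integral_const_mul,
    ← integral_add (integrableOn_borel_mul _) ((integrableOn_borel_mul _).const_mul I)]
  congr 1; ext t
  simp only [TestFunction.postcompCLM_apply, Function.comp, reCLM_apply, imCLM_apply]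
  conv_rhs => rw [← re_add_im (ψ t)]
  ring

/-- Because `borel` is continuous up to the axis, the distributional limit is an ordinary one,
dominated on the compact support of the test function. -/
theorem tendsto_integral_borel (φ : 𝓓((⊤ : TopologicalSpace.Opens ℝ), ℝ)) :
    Tendsto (fun ε : ℝ => ∫ t in Set.Ioi (0 : ℝ), borel (t + ε * I) * (φ t : ℂ))
      (𝓝[>] 0) (𝓝 (borelDist φ)) := by
  obtain ⟨C, hC0, hC⟩ := exists_norm_borel_le
  rw [borelDist_apply]
  have hcs : HasCompactSupport fun t : ℝ => C * (|t| + 1) ^ 4 * |φ t| :=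
    (φ.hasCompactSupport.comp_left (g := fun x : ℝ => |x|) abs_zero).mul_left
  have hcont : Continuous fun t : ℝ => C * (|t| + 1) ^ 4 * |φ t| := by
    have := φ.continuous
    fun_prop
  refine tendsto_integral_filter_of_dominated_convergence
    (fun t => C * (|t| + 1) ^ 4 * |φ t|) ?_ ?_
    (hcont.integrable_of_hasCompactSupport hcs).integrableOn ?_
  · filter_upwards [self_mem_nhdsWithin] with ε hε
    have hε0 : (0 : ℝ) < ε := hε
    refine (Continuous.mul ?_ ?_).aestronglyMeasurable
    · refine differentiableOn_borel.continuousOn.comp_continuous (by fun_prop) fun t => Or.inr ?_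
      simpa using hε0
    · exact continuous_ofReal.comp φ.continuous
  · filter_upwards [Ioc_mem_nhdsGT (show (0 : ℝ) < 1 by norm_num)] with ε hε
    filter_upwards with t
    rw [norm_mul, norm_real, Real.norm_eq_abs]
    refine mul_le_mul_of_nonneg_right ((hC _).trans ?_) (abs_nonneg _)
    have h1 : ‖(t : ℂ) + ε * I‖ ≤ |t| + 1 := by
      refine (norm_add_le _ _).trans ?_
      rw [norm_mul, norm_I, mul_one, norm_real, norm_real, Real.norm_eq_abs,
        Real.norm_of_nonneg hε.1.le]
      linarith [hε.2]
    gcongr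
  · filter_upwards [ae_restrict_mem measurableSet_Ioi] with t ht
    have ht0 : (0 : ℝ) < t := ht
    refine Tendsto.mul_const _ ?_
    have h1 : ContinuousWithinAt borel {u | 0 ≤ u.im ∧ 0 ≤ u.re} (t : ℂ) :=
      continuousOn_borel _ (by simpa using ht0.le)
    refine h1.tendsto.comp (tendsto_nhdsWithin_iff.2 ⟨?_, ?_⟩)
    · have : Continuous fun ε : ℝ => (t : ℂ) + ε * I := by fun_prop
      simpa using (this.tendsto 0).mono_left nhdsWithin_le_nhds
    · filter_upwards [self_mem_nhdsWithin] with ε hε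
      have hε0 : (0 : ℝ) < ε := hε
      refine ⟨?_, ?_⟩
      · simpa using hε0.le
      · simpa using ht0.le

theorem isBoundaryBorelTransform_borelDist :
    IsBoundaryBorelTransform (sqrtSeries coeff) borelDist := by
  refine ⟨pole 0, Set.univ, borel, pole_pos 0, isOpen_univ, fun _ _ => Set.mem_univ _,
    fun t ht => hasSum_borel (by simpa using ht), ?_, tendsto_integral_borel⟩
  rw [Set.univ_inter]
  exact differentiableOn_borel

/-! ### Upper, lower and distributional Borel sums -/

theorem laplaceTest_apply (χ : 𝓓((⊤ : TopologicalSpace.Opens ℝ), ℝ)) (z : ℂ) (m : ℕ) (t : ℝ) :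
    laplaceTest χ z m t = (χ (t / ((m : ℝ) + 1)) : ℂ) * cexp (-(t : ℂ) / z) := rfl

/-- The Laplace integral converges absolutely, so any bounded cutoff tending pointwise to `1` can be
removed by dominated convergence. -/
theorem hasLaplaceBorelIntegral_borelDist {z : ℂ} (hz : 0 < z.re) :
    HasLaplaceBorelIntegral borelDist z (laplaceBorel z) := by
  obtain ⟨C, hC0, hC⟩ := exists_norm_borel_le
  intro χ hχ
  obtain ⟨M, hM⟩ := χ.continuous.bounded_above_of_compact_support χ.hasCompactSupport
  have hp := inv_re_pos hz
  refine Tendsto.const_mul _ ?_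
  simp only [pair_borelDist, laplaceTest_apply]
  have hexp : ∀ t : ℝ, cexp (-(t : ℂ) / z) = cexp (-(z⁻¹ * t)) := fun t => by
    congr 1; rw [div_eq_inv_mul]; ring
  simp only [hexp]
  refine tendsto_integral_of_dominated_convergence
    (fun t => M * (C * (t ^ 4 * Real.exp (-((z⁻¹).re * t))))) (fun m => ?_)
    (((integrableOn_pow_mul_exp_neg_mul 4 hp).const_mul C).const_mul M) (fun m => ?_) ?_
  · have h1 : Continuous fun t : ℝ => (χ (t / ((m : ℝ) + 1)) : ℂ) :=
      continuous_ofReal.comp (χ.continuous.comp (by fun_prop))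
    exact ContinuousOn.aestronglyMeasurable
      ((continuousOn_borel_ofReal.mono Set.Ioi_subset_Ici_self).mul
        (h1.continuousOn.mul (by fun_prop))) measurableSet_Ioi
  · filter_upwards [ae_restrict_mem measurableSet_Ioi] with t ht
    have h1 := norm_borel_mul_exp_le hC hC0 (le_refl (z⁻¹).re) ht
    rw [mul_left_comm, norm_mul, norm_real]
    exact mul_le_mul (hM _) h1 (norm_nonneg _) ((norm_nonneg _).trans (hM 0))
  · filter_upwards with t
    have h2 : Tendsto (fun m : ℕ => t / ((m : ℝ) + 1)) atTop (𝓝 0) := by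
      have := (tendsto_one_div_add_atTop_nhds_zero_nat (𝕜 := ℝ)).const_mul t
      simpa [div_eq_mul_inv] using this
    have h3 : Tendsto (fun m : ℕ => (χ (t / ((m : ℝ) + 1)) : ℂ)) atTop (𝓝 1) := by
      have h4 := (χ.continuous.tendsto 0).comp h2
      rw [hχ.self_of_nhds] at h4
      have h5 := (continuous_ofReal.tendsto _).comp h4
      rw [ofReal_one] at h5
      exact h5
    simpa using (h3.mul_const (cexp (-(z⁻¹ * t)))).const_mul (borel t)

/-- The cutoff is real, so conjugating the test function only replaces `z` by its conjugate. This
reduces the lower sum to the upper one. -/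
theorem pair_conjDist_laplaceTest (T : 𝓓'((⊤ : TopologicalSpace.Opens ℝ), ℂ))
    (χ : 𝓓((⊤ : TopologicalSpace.Opens ℝ), ℝ)) (z : ℂ) (m : ℕ) :
    pair (conjDist T) (laplaceTest χ z m) = conj (pair T (laplaceTest χ (conj z) m)) := by
  have hconj : ∀ t : ℝ, laplaceTest χ (conj z) m t = conj (laplaceTest χ z m t) := by
    intro t
    rw [laplaceTest_apply, laplaceTest_apply, map_mul, conj_ofReal, ← exp_conj,
      map_div₀ (starRingEnd ℂ), map_neg, conj_ofReal]
  have hre : TestFunction.postcompCLM reCLM (laplaceTest χ (conj z) m)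
      = TestFunction.postcompCLM reCLM (laplaceTest χ z m) := by
    ext t
    simp only [TestFunction.postcompCLM_apply, Function.comp, reCLM_apply, hconj, conj_re]
  have him : TestFunction.postcompCLM imCLM (laplaceTest χ (conj z) m)
      = -TestFunction.postcompCLM imCLM (laplaceTest χ z m) := by
    ext t
    change (laplaceTest χ (conj z) m t).im = -(laplaceTest χ z m t).im
    rw [hconj, conj_im]
  rw [pair, pair, hre, him, map_neg, map_add, map_mul, conj_I, map_neg]
  simp [conjDist]

theorem HasLaplaceBorelIntegral.conj {T : 𝓓'((⊤ : TopologicalSpace.Opens ℝ), ℂ)} {z L : ℂ}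
    (h : HasLaplaceBorelIntegral T (conj z) L) :
    HasLaplaceBorelIntegral (conjDist T) z (conj L) := by
  intro χ hχ
  have h1 := (continuous_conj.tendsto L).comp (h χ hχ)
  refine h1.congr fun m => ?_
  simp [pair_conjDist_laplaceTest]

theorem pair_PP (T : 𝓓'((⊤ : TopologicalSpace.Opens ℝ), ℂ))
    (ψ : 𝓓((⊤ : TopologicalSpace.Opens ℝ), ℂ)) :
    pair (PP T) ψ = (pair T ψ + pair (conjDist T) ψ) / 2 := by
  have h : ∀ φ, PP T φ = (1 / 2 : ℝ) • (T φ + conjDist T φ) := fun φ => rfl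
  rw [pair, pair, pair, h, h, real_smul, real_smul]
  push_cast
  ring

theorem HasLaplaceBorelIntegral.pp {T : 𝓓'((⊤ : TopologicalSpace.Opens ℝ), ℂ)} {z L L' : ℂ}
    (h : HasLaplaceBorelIntegral T z L) (h' : HasLaplaceBorelIntegral (conjDist T) z L') :
    HasLaplaceBorelIntegral (PP T) z ((L + L') / 2) := by
  intro χ hχ
  refine (((h χ hχ).add (h' χ hχ)).div_const 2).congr fun m => ?_
  rw [pair_PP]; ring

theorem re_pos_of_mem_disk {R : ℝ} (hR : 0 < R) {z : ℂ} (hz : z ∈ disk R) : 0 < z.re := by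
  have h1 : 0 < (z⁻¹).re := (inv_pos.2 hR).trans hz
  simpa using inv_re_pos h1

theorem hasLaplaceBorelIntegral_upper {R : ℝ} (hR : 0 < R) {β : ℂ} (hβ : β ∈ disk R) :
    HasLaplaceBorelIntegral borelDist β (S (β ^ 2)) := by
  have h := re_pos_of_mem_disk hR hβ
  rw [S_sq h]
  exact hasLaplaceBorelIntegral_borelDist h

theorem hasLaplaceBorelIntegral_lower {R : ℝ} (hR : 0 < R) {β : ℂ} (hβ : β ∈ disk R) :
    HasLaplaceBorelIntegral (conjDist borelDist) β (conj (S (conj (β ^ 2)))) := by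
  have h : 0 < (conj β).re := by simpa using re_pos_of_mem_disk hR hβ
  rw [map_pow, S_sq h]
  exact (hasLaplaceBorelIntegral_borelDist h).conj

end

end Schwinger

theorem theorem1p1 :
    -- the improper integral defining `S(α)` converges on the slit plane, and `S` is analytic there
    (∀ α ∈ slitPlane, (∀ T : ℝ, 0 ≤ T →
        IntervalIntegrable (Schwinger.integrand α) volume 0 T) ∧
      Tendsto (Schwinger.actionUpTo α) atTop (𝓝 (Schwinger.S α))) ∧
    AnalyticOnNhd ℂ Schwinger.S slitPlane ∧
    -- sign and growth of the numbers `aₙ`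
    (∀ n, 2 ≤ n → 0 < Schwinger.a n) ∧
    Schwinger.a ~[atTop] (fun n : ℕ =>
      (4 / Real.pi) ^ n * ((2 * n).factorial : ℝ) / (32 * Real.pi ^ 2 * (n : ℝ) ^ 3)) ∧
    -- `∑ (-aₙ) αⁿ` is the perturbation expansion of `S`
    (∀ N : ℕ, (fun α : ℂ => Schwinger.S α - ∑ n ∈ Finset.range N, Schwinger.coeff n * α ^ n)
      =O[𝓝[{α : ℂ | 0 < α.re}] 0] (fun α : ℂ => α ^ N)) ∧
    -- upper, lower and distributional Borel sum in `β = √α`, on every `C_R`,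
    -- hence for all `β` with `Re β > 0`, i.e. for all `α` in the slit plane
    (∀ R : ℝ, 0 < R →
      Schwinger.IsUpperSum (Schwinger.sqrtSeries Schwinger.coeff) R
        (fun β => Schwinger.S (β ^ 2)) ∧
      Schwinger.IsLowerSum (Schwinger.sqrtSeries Schwinger.coeff) R
        (fun β => conj (Schwinger.S (conj (β ^ 2)))) ∧
      Schwinger.IsDistBorelSum (Schwinger.sqrtSeries Schwinger.coeff) R
        (fun β => (Schwinger.S (β ^ 2) + conj (Schwinger.S (conj (β ^ 2)))) / 2)) ∧
    -- for `α ≥ 0` the sum is the real part of `S`; at `α = 0` it is the constant term, `0`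
    (∀ α : ℝ, 0 ≤ α →
      (Schwinger.S α + conj (Schwinger.S (conj (α : ℂ)))) / 2 = ((Schwinger.S α).re : ℂ)) ∧
    Schwinger.S 0 = 0 := by
  refine ⟨fun α hα => Schwinger.converges hα, Schwinger.analyticOnNhd_S,
    fun n hn => Schwinger.a_pos hn, Schwinger.a_isEquivalent, Schwinger.expansion,
    fun R hR => ⟨?_, ?_, ?_⟩, fun α _ => Schwinger.half_add_conj_S, Schwinger.S_zero⟩
  · exact ⟨_, Schwinger.isBoundaryBorelTransform_borelDist,
      fun β hβ => Schwinger.hasLaplaceBorelIntegral_upper hR hβ⟩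
  · exact ⟨_, Schwinger.isBoundaryBorelTransform_borelDist,
      fun β hβ => Schwinger.hasLaplaceBorelIntegral_lower hR hβ⟩
  · exact ⟨_, Schwinger.isBoundaryBorelTransform_borelDist,
      fun β hβ => (Schwinger.hasLaplaceBorelIntegral_upper hR hβ).pp
        (Schwinger.hasLaplaceBorelIntegral_lower hR hβ)⟩
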